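/- Let $R$ and $S$ be associative rings with unit and let ${}_R\omega_S$ be a semidualizing $(R,S)$-bimodule, i.e. (a) ${}_R\omega$ and $\omega_S$ each admit a resolution by finitely generated projective $R$-modules, respectively $S^{op}$-modules; (b) the homothety maps $R\to\mathrm{Hom}_{S^{op}}(\omega,\omega)$ and $S\to\mathrm{Hom}_R(\omega,\omega)$ are isomorphisms; (c) $\mathrm{Ext}_R^{i}(\omega,\omega)=0=\mathrm{Ext}^{i}_{S^{op}}(\omega,\omega)$ for all $i\ge 1$. Write $M_*=\mathrm{Hom}_R(\omega,M)$ for a left $R$-module $M$. Let $\mathcal F_\omega(R)$ (resp. $\mathcal P_\omega(R)$) be the class of left $R$-modules isomorphic to $\omega\otimes_S F$ with $F$ a flat (resp. projective) left $S$-module, and let $\mathcal I_\omega(S)$ be the class of left $S$-modules isomorphic to $\mathrm{Hom}_R(\omega,I)$ with $I$ an injective left $R$-module. For a class $\mathcal X$ of modules, $\mathcal X\text{-}\mathrm{pd}\,M$ is the infimum of the integers $n\ge 0$ for which there is an exact sequence $0\to X_n\to\cdots\to X_0\to M\to 0$ with all $X_i\in\mathcal X$, and $\mathcal X\text{-}\mathrm{id}\,M$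 is the infimum of the integers $n\ge0$ for which there is an exact sequence $0\to M\to X^0\to\cdots\to X^n\to 0$ with all $X^i\in\mathcal X$ (both are $\infty$ if there is no such $n$). The flat, projective and injective dimensions $\mathrm{fd}$, $\mathrm{pd}$, $\mathrm{id}$ are the usual ones; the zero module has dimension $0$. A left $R$-module $M$ with minimal injective resolution $0\to M\to I^0\xrightarrow{f^0}I^1\to\cdots$ is $\infty$-$\omega$-cotorsionfree if $\mathrm{Tor}_i^S(\omega,\mathrm{Coker}(f^0_*))=0$ for all $i\ge1$, where $f^0_*=\mathrm{Hom}_R(\omega,f^0)$. The Auslander class $\mathcal A_\omega(S)$ consists of the left $S$-modules $N$ such that $\mathrm{Tor}_i^S(\omega,N)=0$ and $\mathrm{Ext}_R^i(\omega,\omega\otimes_SN)=0$ for all $i\ge1$ and the map $\mu_N:N\to(\omega\otimes_SN)_*$, $\mu_N(y)(x)=x\otimes y$, is an isomorphism. Then: 1. For every left $R$-module $M$, $\mathrm{fd}_S M_*\le\mathcal F_\omega(R)\text{-}\mathrm{pd}_R M$, with equality if $M$ is $\infty$-$\omega$-cotorsionfree. 2. For every left $R$-module $M$, $\mathrm{pd}_S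 M_*\le\mathcal P_\omega(R)\text{-}\mathrm{pd}_R M$, with equality if $M$ is $\infty$-$\omega$-cotorsionfree. 3. For every left $S$-module $N$, $\mathrm{id}_R(\omega\otimes_S N)\le\mathcal I_\omega(S)\text{-}\mathrm{id}_S N$, with equality if $N\in\mathcal A_\omega(S)$. -/

import Mathlib

universe u

open CategoryTheory TensorProduct

noncomputable section

namespace SemiDual

/-! ### Tensor product over a noncommutative ring

A right `S`-module is a module over `Sᵐᵒᵖ`, with `x s = MulOpposite.op s • x`. -/

section Tensor

variable (S : Type u) [Ring S]

/-- The relations `(x s) ⊗ n = x ⊗ (s n)`. -/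
def balancedRel (A N : Type u) [AddCommGroup A] [Module Sᵐᵒᵖ A] [AddCommGroup N] [Module S N] :
    Submodule ℤ (A ⊗[ℤ] N) :=
  Submodule.span ℤ {t | ∃ (x : A) (s : S) (n : N),
    t = (MulOpposite.op s • x) ⊗ₜ[ℤ] n - x ⊗ₜ[ℤ] (s • n)}

/-- The tensor product `A ⊗_S N` of a right `S`-module `A` and a left `S`-module `N`. -/
def BTensor (A N : Type u) [AddCommGroup A] [Module Sᵐᵒᵖ A] [AddCommGroup N] [Module S N] :
    Type u :=
  (A ⊗[ℤ] N) ⧸ balancedRel S A N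

namespace BTensor

instance instAddCommGroup (A N : Type u) [AddCommGroup A] [Module Sᵐᵒᵖ A] [AddCommGroup N]
    [Module S N] : AddCommGroup (BTensor S A N) :=
  inferInstanceAs (AddCommGroup ((A ⊗[ℤ] N) ⧸ balancedRel S A N))

variable {A B N N' : Type u} [AddCommGroup A] [Module Sᵐᵒᵖ A] [AddCommGroup B] [Module Sᵐᵒᵖ B]
  [AddCommGroup N] [Module S N] [AddCommGroup N'] [Module S N']

/-- The quotient map `A ⊗_ℤ N → A ⊗_S N`. -/
def mk : A ⊗[ℤ] N →+ BTensor S A N :=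
  (balancedRel S A N).mkQ.toAddMonoidHom

theorem mk_surjective : Function.Surjective (mk S : A ⊗[ℤ] N →+ BTensor S A N) :=
  (balancedRel S A N).mkQ_surjective

/-- The class of `x ⊗ n` in `A ⊗_S N`. -/
def tmul (x : A) (n : N) : BTensor S A N :=
  mk S (x ⊗ₜ[ℤ] n)

theorem tmul_add (x : A) (n n' : N) : tmul S x (n + n') = tmul S x n + tmul S x n' := by
  simp only [tmul, TensorProduct.tmul_add, map_add]

theorem add_tmul (x x' : A) (n : N) : tmul S (x + x') n = tmul S x n + tmul S x' n := by
  simp only [tmul, TensorProduct.add_tmul, map_add]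

theorem smul_tmul (x : A) (s : S) (n : N) :
    tmul S (MulOpposite.op s • x) n = tmul S x (s • n) :=
  (Submodule.Quotient.eq _).2 (Submodule.subset_span ⟨x, s, n, rfl⟩)

/-- The homomorphism on `A ⊗_S N` induced by a biadditive balanced map. -/
def lift {G : Type u} [AddCommGroup G] (b : A →+ N →+ G)
    (hb : ∀ (x : A) (s : S) (n : N), b (MulOpposite.op s • x) n = b x (s • n)) :
    BTensor S A N →+ G :=
  ((balancedRel S A N).liftQ
    (TensorProduct.liftAddHom b (fun r x n => by simp)).toIntLinearMap (by
      refine Submodule.span_le.2 ?_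
      rintro _ ⟨x, s, n, rfl⟩
      simp [hb])).toAddMonoidHom

@[simp] theorem lift_tmul {G : Type u} [AddCommGroup G] (b : A →+ N →+ G)
    (hb : ∀ (x : A) (s : S) (n : N), b (MulOpposite.op s • x) n = b x (s • n)) (x : A) (n : N) :
    lift S b hb (tmul S x n) = b x n :=
  rfl

@[elab_as_elim]
theorem induction_on {p : BTensor S A N → Prop} (t : BTensor S A N)
    (zero : p 0) (tmul : ∀ x n, p (tmul S x n)) (add : ∀ t t', p t → p t' → p (t + t')) :
    p t := by
  obtain ⟨z, rfl⟩ := mk_surjective S t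
  induction z using TensorProduct.induction_on with
  | zero => rw [map_zero]; exact zero
  | tmul x n => exact tmul x n
  | add z z' h h' =>
    rw [map_add]
    exact add _ _ h h'

theorem hom_ext {G : Type u} [AddCommGroup G] {f g : BTensor S A N →+ G}
    (h : ∀ x n, f (tmul S x n) = g (tmul S x n)) : f = g := by
  ext t
  induction t using induction_on with
  | zero => simp
  | tmul x n => exact h x n
  | add t t' h h' => rw [map_add, map_add, h, h']

/-- `f ⊗ N : A ⊗_S N → B ⊗_S N` for a homomorphism `f : A → B` of right `S`-modules. -/
def rTensor (N : Type u) [AddCommGroup N] [Module S N] (f : A →ₗ[Sᵐᵒᵖ] B) :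
    BTensor S A N →+ BTensor S B N :=
  lift S
    (AddMonoidHom.mk' (fun x => AddMonoidHom.mk' (fun n => tmul S (f x) n)
      (fun n n' => tmul_add S (f x) n n'))
      (fun x x' => by ext n; simp [add_tmul]))
    (fun x s n => by simp [smul_tmul])

@[simp] theorem rTensor_tmul (f : A →ₗ[Sᵐᵒᵖ] B) (x : A) (n : N) :
    rTensor S N f (tmul S x n) = tmul S (f x) n := by
  simp [rTensor]

section Left

variable (R : Type u) [Ring R] [Module R A] [SMulCommClass R Sᵐᵒᵖ A]

/-- If `A` is an `(R,S)`-bimodule, `A ⊗_S N` is a left `R`-module via `r (x ⊗ n) = (r x) ⊗ n`. -/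
instance instModule : Module R (BTensor S A N) where
  smul r t := rTensor S N (Module.toModuleEnd Sᵐᵒᵖ A r) t
  one_smul t := DFunLike.congr_fun (f := rTensor S N (Module.toModuleEnd Sᵐᵒᵖ A (1 : R)))
    (g := AddMonoidHom.id _) (hom_ext S fun x n => by simp) t
  mul_smul r r' t := DFunLike.congr_fun
    (f := rTensor S N (Module.toModuleEnd Sᵐᵒᵖ A (r * r')))
    (g := (rTensor S N (Module.toModuleEnd Sᵐᵒᵖ A r)).comp
      (rTensor S N (Module.toModuleEnd Sᵐᵒᵖ A r')))
    (hom_ext S fun x n => by simp [mul_smul]) t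
  smul_zero r := map_zero _
  smul_add r t t' := map_add _ t t'
  add_smul r r' t := DFunLike.congr_fun
    (f := rTensor S N (Module.toModuleEnd Sᵐᵒᵖ A (r + r')))
    (g := rTensor S N (Module.toModuleEnd Sᵐᵒᵖ A r) + rTensor S N (Module.toModuleEnd Sᵐᵒᵖ A r'))
    (hom_ext S fun x n => by simp [add_smul, add_tmul]) t
  zero_smul t := DFunLike.congr_fun
    (f := rTensor S N (Module.toModuleEnd Sᵐᵒᵖ A (0 : R))) (g := 0)
    (hom_ext S fun x n => by
      have h := add_tmul S (0 : A) 0 n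
      simpa using h) t

@[simp] theorem smul_tmul_left (r : R) (x : A) (n : N) :
    r • tmul S x n = tmul S (r • x) n :=
  (rTensor_tmul S _ x n).trans (by simp)

variable (A) in
/-- `A ⊗ g : A ⊗_S N → A ⊗_S N'`, as an `R`-linear map, for `g : N → N'`. -/
def lTensor (g : N →ₗ[S] N') : BTensor S A N →ₗ[R] BTensor S A N' :=
  let φ : BTensor S A N →+ BTensor S A N' := lift S
    (AddMonoidHom.mk' (fun x => AddMonoidHom.mk' (fun n => tmul S x (g n))
      (fun n n' => by simp [tmul_add]))
      (fun x x' => by ext n; simp [add_tmul]))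
    (fun x s n => by simp [smul_tmul])
  { toFun := φ
    map_add' := map_add φ
    map_smul' := fun r t => by
      induction t using induction_on with
      | zero => simp
      | tmul x n => simp [φ]
      | add t t' h h' => rw [smul_add, map_add, map_add, smul_add, h, h'] }

@[simp] theorem lTensor_tmul (g : N →ₗ[S] N') (x : A) (n : N) :
    lTensor S A R g (tmul S x n) = tmul S x (g n) :=
  rfl

theorem linearMap_ext {G : Type u} [AddCommGroup G] [Module R G] {f g : BTensor S A N →ₗ[R] G}
    (h : ∀ x n, f (tmul S x n) = g (tmul S x n)) : f = g :=
  LinearMap.toAddMonoidHom_injective (hom_ext S h)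

end Left

end BTensor

/-- A left `S`-module `F` is flat if `- ⊗_S F` preserves injections of right `S`-modules. -/
def IsFlat (F : Type u) [AddCommGroup F] [Module S F] : Prop :=
  ∀ (A B : Type u) [AddCommGroup A] [Module Sᵐᵒᵖ A] [AddCommGroup B] [Module Sᵐᵒᵖ B]
    (f : A →ₗ[Sᵐᵒᵖ] B), Function.Injective f → Function.Injective (BTensor.rTensor S F f)

end Tensor

/-! ### Functors attached to an `(R,S)`-bimodule `ω` -/

section Bimodule

variable (R S : Type u) [Ring R] [Ring S] (ω : Type u) [AddCommGroup ω] [Module R ω]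
  [Module Sᵐᵒᵖ ω] [SMulCommClass R Sᵐᵒᵖ ω]

/-- The functor `ω ⊗_S -` from left `S`-modules to left `R`-modules. -/
def tensorFunctor : ModuleCat.{u} S ⥤ ModuleCat.{u} R where
  obj N := ModuleCat.of R (BTensor S ω N)
  map g := ModuleCat.ofHom (BTensor.lTensor S ω R g.hom)
  map_id N := ModuleCat.hom_ext (BTensor.linearMap_ext S R fun x n => by simp)
  map_comp f g := ModuleCat.hom_ext (BTensor.linearMap_ext S R fun x n => by simp)

instance tensorFunctor_additive : (tensorFunctor R S ω).Additive where
  map_add := ModuleCat.hom_ext (BTensor.linearMap_ext S R fun x _ =>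
    BTensor.tmul_add S x _ _)

/-- `Tor_i^S(ω, N)`, the `i`-th left derived functor of `ω ⊗_S -`. -/
def tor (i : ℕ) (N : ModuleCat.{u} S) : ModuleCat.{u} R :=
  ((tensorFunctor R S ω).leftDerived i).obj N

/-- Right multiplication `x ↦ x s` on `ω`, an `R`-linear map. -/
def rightMul (s : S) : ω →ₗ[R] ω where
  toFun x := MulOpposite.op s • x
  map_add' := smul_add _
  map_smul' r x := (smul_comm r (MulOpposite.op s) x).symm

/-- `M_* = Hom_R(ω, M)`, to be regarded as a left `S`-module. -/
def HomFrom (R _S : Type u) [Ring R] (ω : Type u) [AddCommGroup ω] [Module R ω]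
    (M : Type u) [AddCommGroup M] [Module R M] : Type u :=
  ω →ₗ[R] M

namespace HomFrom

variable (M M' : Type u) [AddCommGroup M] [Module R M] [AddCommGroup M'] [Module R M']

instance instAddCommGroup : AddCommGroup (HomFrom R S ω M) :=
  inferInstanceAs (AddCommGroup (ω →ₗ[R] M))

/-- The left `S`-module structure `(s f)(x) = f (x s)` on `Hom_R(ω, M)`. -/
instance instModule : Module S (HomFrom R S ω M) where
  smul s f := LinearMap.comp (show ω →ₗ[R] M from f) (rightMul R S ω s)
  one_smul f := LinearMap.ext fun x => congrArg (show ω →ₗ[R] M from f) (one_smul Sᵐᵒᵖ x)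
  mul_smul s s' f := LinearMap.ext fun x =>
    congrArg (show ω →ₗ[R] M from f) (mul_smul (MulOpposite.op s') (MulOpposite.op s) x)
  smul_zero _ := LinearMap.zero_comp _
  smul_add _ _ _ := LinearMap.add_comp _ _ _
  add_smul s s' f := LinearMap.ext fun x =>
    (congrArg (show ω →ₗ[R] M from f)
      (add_smul (MulOpposite.op s) (MulOpposite.op s') x)).trans
      (map_add (show ω →ₗ[R] M from f) _ _)
  zero_smul f := LinearMap.ext fun x =>
    (congrArg (show ω →ₗ[R] M from f) (zero_smul Sᵐᵒᵖ x)).trans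
      (map_zero (show ω →ₗ[R] M from f))

variable {M M'}

/-- `f_* : Hom_R(ω, M) → Hom_R(ω, M')` for `f : M → M'`. -/
def map (f : M →ₗ[R] M') : HomFrom R S ω M →ₗ[S] HomFrom R S ω M' where
  toFun g := f.comp (show ω →ₗ[R] M from g)
  map_add' _ _ := LinearMap.comp_add _ _ _
  map_smul' _ _ := rfl

end HomFrom

/-- `y ↦ (x ↦ x ⊗ y)`, with values in the `R`-linear maps `ω → ω ⊗_S N`. -/
def tmulRight {N : Type u} [AddCommGroup N] [Module S N] (y : N) : ω →ₗ[R] BTensor S ω N where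
  toFun x := BTensor.tmul S x y
  map_add' x x' := BTensor.add_tmul S x x' y
  map_smul' r x := (BTensor.smul_tmul_left S R r x y).symm

/-- `μ_N : N → (ω ⊗_S N)_*`, `μ_N(y)(x) = x ⊗ y`. -/
def unitMap (N : Type u) [AddCommGroup N] [Module S N] :
    N →ₗ[S] HomFrom R S ω (BTensor S ω N) where
  toFun y := tmulRight R S ω y
  map_add' y y' := LinearMap.ext fun x => BTensor.tmul_add S x y y'
  map_smul' s y := LinearMap.ext fun x => (BTensor.smul_tmul S x s y).symm

/-! ### Resolutions and relative dimensions -/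

/-- `M` admits a degreewise finite projective resolution: an exact sequence
`⋯ → P₁ → P₀ → M → 0` with all `Pᵢ` finitely generated projective. -/
def HasDegreewiseFiniteProjRes (T : Type u) [Ring T] (M : Type u) [AddCommGroup M] [Module T M] :
    Prop :=
  ∃ (P : ℕ → ModuleCat.{u} T) (d : ∀ i, P (i + 1) →ₗ[T] P i) (ε : P 0 →ₗ[T] M),
    (∀ i, Module.Finite T (P i) ∧ Module.Projective T (P i)) ∧
    Function.Surjective ε ∧ Function.Exact (d 0) ε ∧ ∀ i, Function.Exact (d (i + 1)) (d i)

/-- There is an exact sequence `0 → Xₙ → ⋯ → X₁ → X₀ → M → 0` with all `Xᵢ` in `𝒳`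
(extended by zero modules in degrees `> n`). -/
def HasResolution {T : Type u} [Ring T] (𝒳 : ModuleCat.{u} T → Prop) (M : ModuleCat.{u} T)
    (n : ℕ) : Prop :=
  ∃ (X : ℕ → ModuleCat.{u} T) (d : ∀ i, X (i + 1) →ₗ[T] X i) (ε : X 0 →ₗ[T] M),
    (∀ i ≤ n, 𝒳 (X i)) ∧ (∀ i > n, Subsingleton (X i)) ∧
    Function.Surjective ε ∧ Function.Exact (d 0) ε ∧ ∀ i, Function.Exact (d (i + 1)) (d i)

/-- There is an exact sequence `0 → M → X⁰ → X¹ → ⋯ → Xⁿ → 0` with all `Xⁱ` in `𝒳`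
(extended by zero modules in degrees `> n`). -/
def HasCoresolution {T : Type u} [Ring T] (𝒳 : ModuleCat.{u} T → Prop) (M : ModuleCat.{u} T)
    (n : ℕ) : Prop :=
  ∃ (X : ℕ → ModuleCat.{u} T) (d : ∀ i, X i →ₗ[T] X (i + 1)) (η : M →ₗ[T] X 0),
    (∀ i ≤ n, 𝒳 (X i)) ∧ (∀ i > n, Subsingleton (X i)) ∧
    Function.Injective η ∧ Function.Exact η (d 0) ∧ ∀ i, Function.Exact (d i) (d (i + 1))

/-- The `𝒳`-projective dimension (`⊤` if there is no finite `𝒳`-resolution). -/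
def relProjDim {T : Type u} [Ring T] (𝒳 : ModuleCat.{u} T → Prop) (M : ModuleCat.{u} T) : ℕ∞ :=
  ⨅ (n : ℕ) (_ : HasResolution 𝒳 M n), (n : ℕ∞)

/-- The `𝒳`-injective dimension (`⊤` if there is no finite `𝒳`-coresolution). -/
def relInjDim {T : Type u} [Ring T] (𝒳 : ModuleCat.{u} T → Prop) (M : ModuleCat.{u} T) : ℕ∞ :=
  ⨅ (n : ℕ) (_ : HasCoresolution 𝒳 M n), (n : ℕ∞)

/-- The flat dimension: the least length of a flat resolution. -/
def flatDim {T : Type u} [Ring T] (M : ModuleCat.{u} T) : ℕ∞ :=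
  relProjDim (fun F : ModuleCat.{u} T => IsFlat T F) M

/-- The projective dimension, with the convention that the zero module has dimension `0`
(Mathlib's value there is `⊥`), in accordance with `relProjDim`. -/
def projDim {T : Type u} [Ring T] (M : ModuleCat.{u} T) : ℕ∞ :=
  (projectiveDimension M).unbotD 0

/-- The injective dimension, with the convention that the zero module has dimension `0`
(Mathlib's value there is `⊥`), in accordance with `relInjDim`. -/
def injDim {T : Type u} [Ring T] (M : ModuleCat.{u} T) : ℕ∞ :=
  (injectiveDimension M).unbotD 0

/-! ### Semidualizing bimodules and the associated classes -/

/-- `ω` is a semidualizing `(R,S)`-bimodule. -/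
structure IsSemidualizing : Prop where
  finite_res_left : HasDegreewiseFiniteProjRes R ω
  finite_res_right : HasDegreewiseFiniteProjRes Sᵐᵒᵖ ω
  /-- `R → Hom_{Sᵒᵖ}(ω, ω)`, `r ↦ (x ↦ r x)`, is bijective. -/
  homothety_left : Function.Bijective (fun r : R => Module.toModuleEnd Sᵐᵒᵖ ω r)
  /-- `S → Hom_R(ω, ω)`, `s ↦ (x ↦ x s)`, is bijective. -/
  homothety_right : Function.Bijective (fun s : S => rightMul R S ω s)
  ext_left : ∀ i ≥ 1, Subsingleton (Abelian.Ext (ModuleCat.of R ω) (ModuleCat.of R ω) i)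
  ext_right : ∀ i ≥ 1, Subsingleton (Abelian.Ext (ModuleCat.of Sᵐᵒᵖ ω) (ModuleCat.of Sᵐᵒᵖ ω) i)

/-- `𝓕_ω(R)`: the modules (isomorphic to) `ω ⊗_S F` with `F` flat. -/
def IsOmegaFlat (M : ModuleCat.{u} R) : Prop :=
  ∃ F : ModuleCat.{u} S, IsFlat S F ∧ Nonempty (M ≃ₗ[R] BTensor S ω F)

/-- `𝓟_ω(R)`: the modules (isomorphic to) `ω ⊗_S P` with `P` projective. -/
def IsOmegaProjective (M : ModuleCat.{u} R) : Prop :=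
  ∃ P : ModuleCat.{u} S, Module.Projective S P ∧ Nonempty (M ≃ₗ[R] BTensor S ω P)

/-- `𝓘_ω(S)`: the modules (isomorphic to) `Hom_R(ω, I)` with `I` injective. -/
def IsOmegaInjective (N : ModuleCat.{u} S) : Prop :=
  ∃ I : ModuleCat.{u} R, Module.Injective R I ∧ Nonempty (N ≃ₗ[S] HomFrom R S ω I)

/-- A submodule is essential if it meets every nonzero submodule nontrivially. -/
def IsEssential {T : Type u} [Ring T] {M : Type u} [AddCommGroup M] [Module T M]
    (K : Submodule T M) : Prop :=
  ∀ L : Submodule T M, K ⊓ L = ⊥ → L = ⊥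

/-- `0 → M → I⁰ → I¹` is the beginning of a minimal injective resolution of `M`:
it is exact, `I⁰` is an injective hull of `M` and `I¹` is an injective hull of the image of `f`. -/
structure IsMinimalInjCopresentation {T : Type u} [Ring T] {M I₀ I₁ : ModuleCat.{u} T}
    (η : M →ₗ[T] I₀) (f : I₀ →ₗ[T] I₁) : Prop where
  injective_zero : Module.Injective T I₀
  injective_one : Module.Injective T I₁
  mono : Function.Injective η
  exact : Function.Exact η f
  essential_zero : IsEssential (LinearMap.range η)
  essential_one : IsEssential (LinearMap.range f)

/-- `Coker f_*`; for `f = f⁰ : I⁰(M) → I¹(M)` in a minimal injective resolution of `M` this is the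
cotranspose of `M`. -/
def cokerStar {I₀ I₁ : ModuleCat.{u} R} (f : I₀ →ₗ[R] I₁) : ModuleCat.{u} S :=
  ModuleCat.of S (HomFrom R S ω I₁ ⧸ LinearMap.range (HomFrom.map R S ω f))

/-- `M` is `n`-`ω`-cotorsionfree: `Tor_i^S(ω, cTr_ω M) = 0` for `1 ≤ i ≤ n`, where
`cTr_ω M = Coker f⁰_*` for a minimal injective resolution of `M` (unique up to isomorphism). -/
def IsCotorsionfree (n : ℕ) (M : ModuleCat.{u} R) : Prop :=
  ∃ (I₀ I₁ : ModuleCat.{u} R) (η : M →ₗ[R] I₀) (f : I₀ →ₗ[R] I₁),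
    IsMinimalInjCopresentation η f ∧
    ∀ i, 1 ≤ i → i ≤ n → Limits.IsZero (tor R S ω i (cokerStar R S ω f))

/-- `M` is `∞`-`ω`-cotorsionfree. -/
def IsInftyCotorsionfree (M : ModuleCat.{u} R) : Prop :=
  ∀ n : ℕ, IsCotorsionfree R S ω n M

/-- The Auslander class `𝓐_ω(S)`. -/
structure InAuslanderClass (N : ModuleCat.{u} S) : Prop where
  tor_zero : ∀ i ≥ 1, Limits.IsZero (tor R S ω i N)
  ext_zero : ∀ i ≥ 1,
    Subsingleton (Abelian.Ext (ModuleCat.of R ω) (ModuleCat.of R (BTensor S ω N)) i)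
  unit_bijective : Function.Bijective (unitMap R S ω N)

end Bimodule

end SemiDual

end

noncomputable section

namespace SemiDual

/-! The functors `ω ⊗_S -` and `Hom_R(ω, -)` carry resolutions back and forth. They are mutually
inverse on the building blocks: `F ≃ (ω ⊗ F)_*` for flat `F` (`unitMap_bijective_of_isFlat`) and `ω
⊗ I_* ≃ I` for injective `I` (`counitMap_bijective_of_injective`). Moreover `Extⁱ(ω, ω ⊗ F)` and
`Torᵢ(ω, I_*)` vanish for `i ≥ 1`.

These facts come from one source. For a finite projective resolution `P` of `ω`, the semidualizing
axioms say that `0 → S → Hom(P₀, ω) → Hom(P₁, ω) → ⋯` is exact, and symmetrically with `R` on the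
other side. Tensoring with a flat `F`, or applying `Hom(-, I)`, keeps exactness. By finiteness of
the `Pᵢ`, the evaluation maps `homTensor` and `tensorHom` identify the results with `Hom(P, ω ⊗ F)`
and `P ⊗ I_*`.

Induction along short exact sequences then gives the three inequalities: the vanishing of Ext or Tor
propagates from the blocks to every syzygy or cosyzygy, so the functor keeps the (co)resolution
exact (`hasResolution_homFrom`, `hasCoresolution_tensor`). For the equalities the other functor is
applied (`hasResolution_tensor`, `hasCoresolution_homFrom`). This needs vanishing for the module
itself and an isomorphism back to it. Membership in the Auslander class provides both by definition;
for a cotorsionfree `M`, both follow by shifting degrees along `0 → M_* → I⁰_* → I¹_* → Coker f⁰_* →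
0`. -/

theorem exists_finite_dual_basis (T : Type u) [Ring T] (M : Type u) [AddCommGroup M] [Module T M]
    [Module.Finite T M] [Module.Projective T M] :
    ∃ (n : ℕ) (x : Fin n → M) (φ : Fin n → M →ₗ[T] T), ∀ m, ∑ i, φ i m • x i = m := by
  obtain ⟨n, f, g, -, -, h⟩ := Module.Finite.exists_comp_eq_id_of_projective T M
  refine ⟨n, fun i => f (Pi.single i 1), fun i => (LinearMap.proj i).comp g, fun m => ?_⟩
  have h' : f (g m) = m := LinearMap.congr_fun h m
  conv_rhs => rw [← h', LinearMap.pi_apply_eq_sum_univ f (g m)]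
  refine Finset.sum_congr rfl fun i _ => ?_
  simp only [LinearMap.comp_apply, LinearMap.proj_apply]
  congr 2
  ext j
  simp [Pi.single_apply, eq_comm]

/-! ### Functoriality and exactness of the balanced tensor product -/

namespace BTensor

variable (S : Type u) [Ring S] {A B C N N' N'' : Type u}
  [AddCommGroup A] [Module Sᵐᵒᵖ A] [AddCommGroup B] [Module Sᵐᵒᵖ B]
  [AddCommGroup C] [Module Sᵐᵒᵖ C] [AddCommGroup N] [Module S N] [AddCommGroup N'] [Module S N']
  [AddCommGroup N''] [Module S N'']

@[simp] theorem tmul_zero (x : A) : tmul S x (0 : N) = 0 := by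
  have h := tmul_add S x (0 : N) 0
  simpa using h

@[simp] theorem zero_tmul (n : N) : tmul S (0 : A) n = 0 := by
  have h := add_tmul S (0 : A) 0 n
  simpa using h

theorem tmul_sub (x : A) (n n' : N) : tmul S x (n - n') = tmul S x n - tmul S x n' :=
  eq_sub_of_add_eq (by rw [← tmul_add, sub_add_cancel])

theorem sub_tmul (x x' : A) (n : N) : tmul S (x - x') n = tmul S x n - tmul S x' n :=
  eq_sub_of_add_eq (by rw [← add_tmul, sub_add_cancel])

theorem sum_tmul {ι : Type*} (s : Finset ι) (x : ι → A) (n : N) :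
    tmul S (∑ i ∈ s, x i) n = ∑ i ∈ s, tmul S (x i) n :=
  map_sum (AddMonoidHom.mk' (fun x => tmul S x n) fun x x' => add_tmul S x x' n) x s

theorem tmul_sum {ι : Type*} (s : Finset ι) (x : A) (n : ι → N) :
    tmul S x (∑ i ∈ s, n i) = ∑ i ∈ s, tmul S x (n i) :=
  map_sum (AddMonoidHom.mk' (fun n => tmul S x n) fun n n' => tmul_add S x n n') n s

variable (A) in
/-- The additive map `A ⊗ g : A ⊗_S N → A ⊗_S N'` for `g : N → N'`. -/
def lMap (g : N →ₗ[S] N') : BTensor S A N →+ BTensor S A N' :=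
  lift S
    (AddMonoidHom.mk' (fun x => AddMonoidHom.mk' (fun n => tmul S x (g n))
      (fun n n' => by simp [tmul_add]))
      (fun x x' => by ext n; simp [add_tmul]))
    (fun x s n => by simp [smul_tmul])

@[simp] theorem lMap_tmul (g : N →ₗ[S] N') (x : A) (n : N) :
    lMap S A g (tmul S x n) = tmul S x (g n) :=
  rfl

/-- The terms of a resolution of `ω` over `Sᵐᵒᵖ` carry no `R`-action, so the diagram chases use the
additive map; exactness statements pass to the `R`-linear one through this identity. -/
theorem lTensor_eq_lMap (R : Type u) [Ring R] [Module R A] [SMulCommClass R Sᵐᵒᵖ A]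
    (g : N →ₗ[S] N') (t : BTensor S A N) : lTensor S A R g t = lMap S A g t :=
  rfl

theorem lMap_rTensor (f : A →ₗ[Sᵐᵒᵖ] B) (g : N →ₗ[S] N') (t : BTensor S A N) :
    lMap S B g (rTensor S N f t) = rTensor S N' f (lMap S A g t) :=
  DFunLike.congr_fun (f := (lMap S B g).comp (rTensor S N f))
    (g := (rTensor S N' f).comp (lMap S A g)) (hom_ext S fun x n => by simp) t

theorem lMap_lMap (f : N →ₗ[S] N') (g : N' →ₗ[S] N'') (t : BTensor S A N) :
    lMap S A g (lMap S A f t) = lMap S A (g.comp f) t :=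
  DFunLike.congr_fun (f := (lMap S A g).comp (lMap S A f))
    (g := lMap S A (g.comp f)) (hom_ext S fun x n => by simp) t

theorem rTensor_rTensor (f : A →ₗ[Sᵐᵒᵖ] B) (g : B →ₗ[Sᵐᵒᵖ] C) (t : BTensor S A N) :
    rTensor S N g (rTensor S N f t) = rTensor S N (g.comp f) t :=
  DFunLike.congr_fun (f := (rTensor S N g).comp (rTensor S N f))
    (g := rTensor S N (g.comp f)) (hom_ext S fun x n => by simp) t

@[simp] theorem lMap_zero (t : BTensor S A N) : lMap S A (0 : N →ₗ[S] N') t = 0 :=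
  DFunLike.congr_fun (f := lMap S A (0 : N →ₗ[S] N')) (g := 0) (hom_ext S fun x n => by simp) t

@[simp] theorem rTensor_zero (t : BTensor S A N) : rTensor S N (0 : A →ₗ[Sᵐᵒᵖ] B) t = 0 :=
  DFunLike.congr_fun (f := rTensor S N (0 : A →ₗ[Sᵐᵒᵖ] B)) (g := 0)
    (hom_ext S fun x n => by simp) t

@[simp] theorem lMap_id (t : BTensor S A N) : lMap S A (LinearMap.id : N →ₗ[S] N) t = t :=
  DFunLike.congr_fun (f := lMap S A (LinearMap.id : N →ₗ[S] N)) (g := AddMonoidHom.id _)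
    (hom_ext S fun x n => by simp) t

theorem lMap_surjective {g : N →ₗ[S] N'} (hg : Function.Surjective g) :
    Function.Surjective (lMap S A g) := fun t => by
  induction t using induction_on with
  | zero => exact ⟨0, map_zero _⟩
  | tmul x n =>
    obtain ⟨m, rfl⟩ := hg n
    exact ⟨tmul S x m, rfl⟩
  | add t t' h h' =>
    obtain ⟨u, rfl⟩ := h
    obtain ⟨u', rfl⟩ := h'
    exact ⟨u + u', map_add _ _ _⟩

theorem rTensor_surjective {f : A →ₗ[Sᵐᵒᵖ] B} (hf : Function.Surjective f) :
    Function.Surjective (rTensor S N f) := fun t => by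
  induction t using induction_on with
  | zero => exact ⟨0, map_zero _⟩
  | tmul x n =>
    obtain ⟨m, rfl⟩ := hf x
    exact ⟨tmul S m n, rTensor_tmul _ _ _ _⟩
  | add t t' h h' =>
    obtain ⟨u, rfl⟩ := h
    obtain ⟨u', rfl⟩ := h'
    exact ⟨u + u', map_add _ _ _⟩

/-- Right exactness of `- ⊗_S N`. -/
theorem rTensor_exact {f : A →ₗ[Sᵐᵒᵖ] B} {g : B →ₗ[Sᵐᵒᵖ] C} (hfg : Function.Exact f g)
    (hg : Function.Surjective g) : Function.Exact (rTensor S N f) (rTensor S N g) := by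
  intro t
  refine ⟨fun ht => ?_, ?_⟩
  · let π := QuotientAddGroup.mk' (rTensor S N f).range
    have hπ : ∀ b b' : B, g b = g b' → ∀ n, π (tmul S b n) = π (tmul S b' n) := by
      intro b b' h n
      obtain ⟨a, ha⟩ := (hfg (b - b')).1 (by rw [map_sub, h, sub_self])
      rw [← sub_eq_zero, ← map_sub, ← sub_tmul, ← ha]
      exact (QuotientAddGroup.eq_zero_iff _).2 ⟨tmul S a n, rTensor_tmul _ _ _ _⟩
    -- The section is only a map of sets. Since `π (b ⊗ n)` depends on `g b` alone, `c ↦ π (s c ⊗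
    -- n)` is still additive and balanced, so `π` factors through `rTensor S N g`.
    let s := Function.surjInv hg
    have hs : ∀ c, g (s c) = c := Function.surjInv_eq hg
    let ψ : BTensor S C N →+ _ := lift S
      (AddMonoidHom.mk' (fun c => AddMonoidHom.mk' (fun n => π (tmul S (s c) n))
        (fun n n' => by rw [tmul_add, map_add]))
        (fun c c' => by
          ext n
          refine (hπ _ (s c + s c') (by rw [hs, map_add, hs, hs]) n).trans ?_
          rw [add_tmul, map_add]; rfl))
      (fun c r n => by
        refine (hπ _ (MulOpposite.op r • s c) (by rw [hs, map_smul, hs]) n).trans ?_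
        rw [smul_tmul]; rfl)
    have h : ψ.comp (rTensor S N g) = π := hom_ext S fun b n => by
      rw [AddMonoidHom.comp_apply, rTensor_tmul]
      exact hπ _ _ (hs _) n
    have h2 : π t = 0 := by rw [← h, AddMonoidHom.comp_apply, ht, map_zero]
    exact (QuotientAddGroup.eq_zero_iff _).1 h2
  · rintro ⟨u, rfl⟩
    rw [rTensor_rTensor, show g.comp f = 0 from LinearMap.ext hfg.apply_apply_eq_zero]
    exact rTensor_zero S u

/-- Right exactness of `A ⊗_S -`. -/
theorem lMap_exact {f : N →ₗ[S] N'} {g : N' →ₗ[S] N''} (hfg : Function.Exact f g)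
    (hg : Function.Surjective g) : Function.Exact (lMap S A f) (lMap S A g) := by
  intro t
  refine ⟨fun ht => ?_, ?_⟩
  · let π := QuotientAddGroup.mk' (lMap S A f).range
    have hπ : ∀ b b' : N', g b = g b' → ∀ x, π (tmul S x b) = π (tmul S x b') := by
      intro b b' h x
      obtain ⟨a, ha⟩ := (hfg (b - b')).1 (by rw [map_sub, h, sub_self])
      rw [← sub_eq_zero, ← map_sub, ← tmul_sub, ← ha]
      exact (QuotientAddGroup.eq_zero_iff _).2 ⟨tmul S x a, rfl⟩
    let s := Function.surjInv hg
    have hs : ∀ c, g (s c) = c := Function.surjInv_eq hg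
    let ψ : BTensor S A N'' →+ _ := lift S
      (AddMonoidHom.mk' (fun x => AddMonoidHom.mk' (fun c => π (tmul S x (s c)))
        (fun c c' => by
          refine (hπ _ (s c + s c') (by rw [hs, map_add, hs, hs]) x).trans ?_
          rw [tmul_add, map_add]))
        (fun x x' => by
          ext n
          simp [add_tmul]))
      (fun x r c => by
        refine Eq.trans ?_ (hπ (r • s c) _ (by rw [hs, map_smul, hs]) x)
        rw [← smul_tmul]; rfl)
    have h : ψ.comp (lMap S A g) = π := hom_ext S fun x b => by
      rw [AddMonoidHom.comp_apply, lMap_tmul]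
      exact hπ _ _ (hs _) x
    have h2 : π t = 0 := by rw [← h, AddMonoidHom.comp_apply, ht, map_zero]
    exact (QuotientAddGroup.eq_zero_iff _).1 h2
  · rintro ⟨u, rfl⟩
    rw [lMap_lMap, show g.comp f = 0 from LinearMap.ext hfg.apply_apply_eq_zero]
    exact lMap_zero S u

/-- The map `Q ⊗_S N → N`, `q ⊗ n ↦ φ(q) n`, attached to a functional `φ` on `Q`. -/
def contract (φ : A →ₗ[Sᵐᵒᵖ] Sᵐᵒᵖ) : BTensor S A N →+ N :=
  lift S
    (AddMonoidHom.mk' (fun x => AddMonoidHom.mk' (fun n => (φ x).unop • n)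
      (fun n n' => smul_add _ _ _))
      (fun x x' => by ext n; simp [add_smul]))
    (fun x s n => by simp [mul_smul])

@[simp] theorem contract_tmul (φ : A →ₗ[Sᵐᵒᵖ] Sᵐᵒᵖ) (x : A) (n : N) :
    contract S φ (tmul S x n) = (φ x).unop • n :=
  rfl

/-- Finitely generated projective right modules are flat. -/
theorem lMap_injective [Module.Finite Sᵐᵒᵖ A] [Module.Projective Sᵐᵒᵖ A] {g : N →ₗ[S] N'}
    (hg : Function.Injective g) : Function.Injective (lMap S A g) := by
  obtain ⟨k, x, φ, h⟩ := exists_finite_dual_basis Sᵐᵒᵖ A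
  -- An element of the tensor product is recovered from its contractions with the dual basis. These
  -- are natural in `N`, so an injective `g` detects whether they vanish.
  have key : ∀ t : BTensor S A N, ∑ i, tmul S (x i) (contract S (φ i) t) = t := by
    intro t
    induction t using induction_on with
    | zero => simp
    | tmul a n =>
      simp only [contract_tmul, ← smul_tmul, ← sum_tmul]
      exact congrArg (fun a => tmul S a n) (h a)
    | add t t' h h' => simp only [map_add, tmul_add, Finset.sum_add_distrib, h, h']
  have nat : ∀ (i) (t : BTensor S A N), contract S (φ i) (lMap S A g t) = g (contract S (φ i) t) := by
    intro i t
    induction t using induction_on with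
    | zero => simp
    | tmul a n => simp
    | add t t' h h' => simp only [map_add, h, h']
  refine (injective_iff_map_eq_zero _).2 fun t ht => ?_
  rw [← key t]
  refine Finset.sum_eq_zero fun i _ => ?_
  have := nat i t
  rw [ht, map_zero] at this
  rw [(injective_iff_map_eq_zero g).1 hg _ this.symm, tmul_zero]

end BTensor

/-! ### Flat modules and extension of maps into injectives -/

variable (S : Type u) [Ring S]

open BTensor

/-- Factor `g` through its range: right exactness handles the surjective part, flatness the
inclusion. -/
theorem IsFlat.exact {F : Type u} [AddCommGroup F] [Module S F] (hF : IsFlat S F)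
    {A B C : Type u} [AddCommGroup A] [Module Sᵐᵒᵖ A] [AddCommGroup B] [Module Sᵐᵒᵖ B]
    [AddCommGroup C] [Module Sᵐᵒᵖ C] {f : A →ₗ[Sᵐᵒᵖ] B} {g : B →ₗ[Sᵐᵒᵖ] C}
    (hfg : Function.Exact f g) : Function.Exact (rTensor S F f) (rTensor S F g) := by
  have h₁ : Function.Exact f g.rangeRestrict := fun b => by
    rw [← hfg b, ← Subtype.coe_inj]; rfl
  have h₂ := rTensor_exact S (N := F) h₁ g.surjective_rangeRestrict
  intro t
  rw [← h₂ t]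
  have h₃ : rTensor S F g t = rTensor S F (LinearMap.range g).subtype
      (rTensor S F g.rangeRestrict t) := by
    rw [rTensor_rTensor]; rfl
  rw [h₃, map_eq_zero_iff _ (hF _ _ _ (Submodule.subtype_injective _))]

theorem IsFlat.of_equiv {F F' : Type u} [AddCommGroup F] [Module S F] [AddCommGroup F']
    [Module S F'] (e : F ≃ₗ[S] F') (hF : IsFlat S F) : IsFlat S F' := by
  intro A B _ _ _ _ f hf
  have hinj : Function.Injective (lMap S A e.symm.toLinearMap) :=
    Function.LeftInverse.injective (g := lMap S A e.toLinearMap) fun t => by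
      rw [lMap_lMap]; simp
  refine Function.Injective.of_comp (f := lMap S B e.symm.toLinearMap) ?_
  have : (lMap S B e.symm.toLinearMap) ∘ (rTensor S F' f) =
      (rTensor S F f) ∘ (lMap S A e.symm.toLinearMap) := funext fun t => lMap_rTensor S _ _ t
  rw [this]
  exact (hF A B f hf).comp hinj

/-- For a map `s : N → S^(N)` the map `A ⊗_S N → A^(N)`, `a ⊗ n ↦ (a s(n)_j)_j`. -/
def coordinates (A : Type u) [AddCommGroup A] [Module Sᵐᵒᵖ A] {N : Type u} [AddCommGroup N]
    [Module S N] (s : N →ₗ[S] N →₀ S) : BTensor S A N →+ N →₀ A :=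
  lift S
    (AddMonoidHom.mk' (fun a => AddMonoidHom.mk'
      (fun n => (s n).mapRange (fun r => MulOpposite.op r • a) (by simp))
      (fun n n' => by ext j; simp [add_smul]))
      (fun a a' => by ext n j; simp))
    (fun a r n => by ext j; simp [mul_smul])

@[simp] theorem coordinates_tmul (A : Type u) [AddCommGroup A] [Module Sᵐᵒᵖ A] {N : Type u}
    [AddCommGroup N] [Module S N] (s : N →ₗ[S] N →₀ S) (a : A) (n j : N) :
    coordinates S A s (tmul S a n) j = MulOpposite.op (s n j) • a :=
  rfl

/-- A splitting of the free cover of `N` serves as a possibly infinite dual basis. The resulting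
coordinates determine `t` and are natural in the right module, so injectivity of `f` can be tested
on them. -/
theorem IsFlat.of_projective {N : Type u} [AddCommGroup N] [Module S N] [Module.Projective S N] :
    IsFlat S N := by
  obtain ⟨s, hs⟩ := Module.projective_def'.1 (inferInstance : Module.Projective S N)
  intro A B _ _ _ _ f hf
  have key : ∀ t : BTensor S A N, (coordinates S A s t).sum (fun j a => tmul S a j) = t := by
    intro t
    induction t using induction_on with
    | zero => simp
    | tmul a n =>
      have h : (s n).sum (fun j r => r • j) = n := LinearMap.congr_fun hs n
      -- The support of the coordinates can be smaller than that of `s n`, because a nonzero scalar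
      -- may kill `a`.
      rw [Finsupp.sum_of_support_subset (s := (s n).support) _ ?_ _ (by simp)]
      · simp only [coordinates_tmul, smul_tmul, ← tmul_sum]
        exact congrArg (tmul S a) h
      · intro j
        simp only [Finsupp.mem_support_iff, coordinates_tmul]
        intro h h'
        simp [h'] at h
    | add t t' h h' =>
      rw [map_add, Finsupp.sum_add_index' (by simp) (fun j a a' => add_tmul S a a' j), h, h']
  have nat : ∀ (t : BTensor S A N) (j), coordinates S B s (rTensor S N f t) j =
      f (coordinates S A s t j) := by
    intro t j
    induction t using induction_on with
    | zero => simp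
    | tmul a n => simp
    | add t t' h h' => simp only [map_add, Finsupp.add_apply, h, h']
  refine (injective_iff_map_eq_zero _).2 fun t ht => ?_
  have : coordinates S A s t = 0 := by
    ext j
    have h := nat t j
    rw [ht, map_zero, Finsupp.zero_apply] at h
    exact (injective_iff_map_eq_zero f).1 hf _ h.symm
  rw [← key t, this, Finsupp.sum_zero_index]

/-- Exactness of `Hom(-, I)` for an injective module `I`. -/
theorem exists_extension_of_exact {T : Type u} [Ring T] {A B C I : Type u} [AddCommGroup A]
    [Module T A] [AddCommGroup B] [Module T B] [AddCommGroup C] [Module T C] [AddCommGroup I]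
    [Module T I] (hI : Module.Injective T I) {v : A →ₗ[T] B} {w : B →ₗ[T] C}
    (h : Function.Exact v w) (f : B →ₗ[T] I) (hf : f.comp v = 0) :
    ∃ g : C →ₗ[T] I, g.comp w = f := by
  let f' : LinearMap.range w →ₗ[T] I :=
    ((LinearMap.ker w).liftQ f (by
      intro x hx
      obtain ⟨y, rfl⟩ := (h x).1 hx
      exact LinearMap.congr_fun hf y)).comp w.quotKerEquivRange.symm.toLinearMap
  obtain ⟨g, hg⟩ := hI.out (LinearMap.range w).subtype (Submodule.subtype_injective _) f'
  refine ⟨g, LinearMap.ext fun x => (hg ⟨w x, x, rfl⟩).trans ?_⟩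
  simp only [f', LinearMap.comp_apply, LinearEquiv.coe_coe]
  erw [LinearMap.quotKerEquivRange_symm_apply_image]
  rfl

/-! ### Projective resolutions as sequences of modules -/

/-- A resolution `⋯ → P₁ → P₀ → X → 0` by projective modules. -/
structure ProjRes (T : Type u) [Ring T] (X : Type u) [AddCommGroup X] [Module T X] where
  /-- The terms. -/
  P : ℕ → ModuleCat.{u} T
  /-- The differentials. -/
  d : ∀ i, P (i + 1) →ₗ[T] P i
  /-- The augmentation. -/
  ε : P 0 →ₗ[T] X
  projective : ∀ i, Module.Projective T (P i)
  surjective : Function.Surjective ε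
  exact_zero : Function.Exact (d 0) ε
  exact_succ : ∀ i, Function.Exact (d (i + 1)) (d i)

namespace ProjRes

attribute [instance] ProjRes.projective

section

variable {T : Type u} [Ring T] {X : Type u} [AddCommGroup X] [Module T X] (Q : ProjRes T X)

/-- All terms of the resolution are finitely generated. -/
class DegreewiseFinite : Prop where
  finite : ∀ i, Module.Finite T (Q.P i)

attribute [instance] DegreewiseFinite.finite

theorem ε_comp_d : Q.ε.comp (Q.d 0) = 0 :=
  LinearMap.ext Q.exact_zero.apply_apply_eq_zero

theorem d_comp_d (i : ℕ) : (Q.d i).comp (Q.d (i + 1)) = 0 :=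
  LinearMap.ext (Q.exact_succ i).apply_apply_eq_zero

/-- The induced resolution of the kernel of the augmentation. -/
def shift : ProjRes T (LinearMap.ker Q.ε) where
  P i := Q.P (i + 1)
  d i := Q.d (i + 1)
  ε := (Q.d 0).codRestrict _ Q.exact_zero.apply_apply_eq_zero
  projective i := Q.projective (i + 1)
  surjective := by
    rintro ⟨x, hx⟩
    obtain ⟨y, rfl⟩ := (Q.exact_zero x).1 hx
    exact ⟨y, rfl⟩
  exact_zero y := by
    rw [← Q.exact_succ 0 y, ← Subtype.coe_inj]
    rfl
  exact_succ i := Q.exact_succ (i + 1)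

/-- `Extⁱ⁺¹(X, M) = 0`, expressed by the complex `Hom(P, M)`. -/
def ExtVanishes (i : ℕ) (M : Type u) [AddCommGroup M] [Module T M] : Prop :=
  ∀ f : Q.P (i + 1) →ₗ[T] M, f.comp (Q.d (i + 1)) = 0 → ∃ g : Q.P i →ₗ[T] M, g.comp (Q.d i) = f

theorem extVanishes_of_injective (i : ℕ) {M : Type u} [AddCommGroup M] [Module T M]
    (hM : Module.Injective T M) : Q.ExtVanishes i M :=
  fun f hf => exists_extension_of_exact hM (Q.exact_succ i) f hf

/-- `X` is the cokernel of `Q.d 0`. -/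
theorem exists_factor_augmentation {M : Type u} [AddCommGroup M] [Module T M]
    (f : Q.P 0 →ₗ[T] M) (hf : f.comp (Q.d 0) = 0) : ∃ g : X →ₗ[T] M, g.comp Q.ε = f := by
  refine ⟨((LinearMap.ker Q.ε).liftQ f ?_).comp
    (Q.ε.quotKerEquivOfSurjective Q.surjective).symm.toLinearMap, LinearMap.ext fun x => ?_⟩
  · intro x hx
    obtain ⟨y, rfl⟩ := (Q.exact_zero x).1 hx
    exact LinearMap.congr_fun hf y
  · have : (Q.ε.quotKerEquivOfSurjective Q.surjective).symm (Q.ε x) = Submodule.Quotient.mk x := by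
      rw [LinearEquiv.symm_apply_eq]
      rfl
    simp only [LinearMap.comp_apply, LinearEquiv.coe_coe]
    erw [this]
    rfl

variable {A B C : Type u} [AddCommGroup A] [Module T A] [AddCommGroup B] [Module T B]
  [AddCommGroup C] [Module T C] {f : A →ₗ[T] B} {g : B →ₗ[T] C}

theorem ExtVanishes.of_equiv {i : ℕ} (e : A ≃ₗ[T] B) (hA : Q.ExtVanishes i A) :
    Q.ExtVanishes i B := by
  intro b hb
  obtain ⟨a, ha⟩ := hA (e.symm.toLinearMap.comp b) (by rw [LinearMap.comp_assoc, hb]; simp)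
  refine ⟨e.toLinearMap.comp a, LinearMap.ext fun x => ?_⟩
  have : a (Q.d i x) = e.symm (b x) := LinearMap.congr_fun ha x
  simp [this]

theorem exists_lift_left {Y : Type u} [AddCommGroup Y] [Module T Y] (hf : Function.Injective f)
    (hfg : Function.Exact f g) (h : Y →ₗ[T] B) (hh : g.comp h = 0) :
    ∃ k : Y →ₗ[T] A, f.comp k = h := by
  refine ⟨(LinearEquiv.ofInjective f hf).symm.toLinearMap.comp
    (h.codRestrict (LinearMap.range f) fun y => (hfg _).1 (LinearMap.congr_fun hh y)),
    LinearMap.ext fun y => ?_⟩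
  have := LinearEquiv.apply_symm_apply (LinearEquiv.ofInjective f hf)
    (h.codRestrict (LinearMap.range f) (fun y => (hfg _).1 (LinearMap.congr_fun hh y)) y)
  exact congrArg Subtype.val this

variable (hf : Function.Injective f) (hg : Function.Surjective g) (hfg : Function.Exact f g)
include hf hg hfg

/-- This is the segment `Extⁱ⁺¹(X, B) → Extⁱ⁺¹(X, C) → Extⁱ⁺²(X, A)` of the long exact sequence. A
cocycle lifts to `B` by projectivity; its coboundary lies in `A` and is corrected away. -/
theorem ExtVanishes.of_shortExact {i : ℕ} (hA : Q.ExtVanishes (i + 1) A)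
    (hB : Q.ExtVanishes i B) : Q.ExtVanishes i C := by
  intro c hc
  obtain ⟨b, rfl⟩ := Module.projective_lifting_property g c hg
  obtain ⟨a, ha⟩ := exists_lift_left hf hfg (b.comp (Q.d (i + 1)))
    (by rw [← LinearMap.comp_assoc, hc])
  obtain ⟨a', rfl⟩ := hA a (LinearMap.ext fun x => hf (by
    rw [← LinearMap.comp_apply, ← LinearMap.comp_assoc, ha, LinearMap.comp_assoc, Q.d_comp_d]
    simp))
  obtain ⟨b', hb'⟩ := hB (b - f.comp a') (by
    rw [LinearMap.sub_comp, ← ha, LinearMap.comp_assoc, sub_self])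
  refine ⟨g.comp b', ?_⟩
  rw [LinearMap.comp_assoc, hb', LinearMap.comp_sub, ← LinearMap.comp_assoc,
    show g.comp f = 0 from LinearMap.ext hfg.apply_apply_eq_zero, LinearMap.zero_comp, sub_zero]

/-- The index `0` stands for `Ext¹(X, A)`, the obstruction to surjectivity of `Hom(X, B) → Hom(X,
C)`. -/
theorem ExtVanishes.exists_lift (hA : Q.ExtVanishes 0 A) (c : X →ₗ[T] C) :
    ∃ b : X →ₗ[T] B, g.comp b = c := by
  obtain ⟨b, hb⟩ := Module.projective_lifting_property g (c.comp Q.ε) hg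
  obtain ⟨a, ha⟩ := exists_lift_left hf hfg (b.comp (Q.d 0))
    (by rw [← LinearMap.comp_assoc, hb, LinearMap.comp_assoc, Q.ε_comp_d, LinearMap.comp_zero])
  obtain ⟨a', rfl⟩ := hA a (LinearMap.ext fun x => hf (by
    rw [← LinearMap.comp_apply, ← LinearMap.comp_assoc, ha, LinearMap.comp_assoc, Q.d_comp_d]
    simp))
  obtain ⟨b', hb'⟩ := Q.exists_factor_augmentation (b - f.comp a') (by
    rw [LinearMap.sub_comp, ← ha, LinearMap.comp_assoc, sub_self])
  refine ⟨b', LinearMap.ext fun x => ?_⟩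
  obtain ⟨p, rfl⟩ := Q.surjective x
  have h₁ : b' (Q.ε p) = b p - f (a' p) := LinearMap.congr_fun hb' p
  have h₂ : g (b p) = c (Q.ε p) := LinearMap.congr_fun hb p
  rw [LinearMap.comp_apply, h₁, map_sub, hfg.apply_apply_eq_zero, sub_zero, h₂]

end

/-! ### Comparison with `Abelian.Ext` -/

section Ext

variable {T : Type u} [Ring T]

/-- Vanishing of `Abelian.Ext` is detected by any projective resolution. -/
theorem extVanishes_of_subsingleton_ext (M : ModuleCat.{u} T) (i : ℕ) :
    ∀ {X : Type u} [AddCommGroup X] [Module T X] (Q : ProjRes T X),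
      Subsingleton (Abelian.Ext (ModuleCat.of T X) M (i + 1)) → Q.ExtVanishes i M := by
  induction i with
  | zero =>
    intro X _ _ Q h f hf
    have hS := Q.ε.shortExact_shortComplexKer Q.surjective
    -- A 1-cocycle is a map out of the first syzygy, and `Ext¹ = 0` extends that map to `Q.P 0`.
    obtain ⟨k, rfl⟩ := Q.shift.exists_factor_augmentation f hf
    obtain ⟨x, hx⟩ := Abelian.Ext.contravariant_sequence_exact₁ hS M
      (Abelian.Ext.mk₀ (ModuleCat.ofHom k)) (n₁ := 0 + 1) rfl (Subsingleton.elim _ _)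
    obtain ⟨l, rfl⟩ := Abelian.Ext.addEquiv₀.symm.surjective x
    rw [Abelian.Ext.addEquiv₀_symm_apply, Abelian.Ext.mk₀_comp_mk₀] at hx
    have hx' := (Abelian.Ext.mk₀_bijective _ _).1 hx
    refine ⟨l.hom, LinearMap.ext fun p => ?_⟩
    exact LinearMap.congr_fun (congrArg ModuleCat.Hom.hom hx') (Q.shift.ε p)
  | succ i ih =>
    intro X _ _ Q h
    refine ih Q.shift ?_
    have hS := Q.ε.shortExact_shortComplexKer Q.surjective
    have : Projective (Q.ε.shortComplexKer).X₂ :=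
      (IsProjective.iff_projective _).1 (Q.projective 0)
    -- Dimension shifting: a class on the syzygy has zero image under the connecting map, so it
    -- comes from `Ext` of the projective `Q.P 0`.
    refine subsingleton_of_forall_eq 0 fun x => ?_
    obtain ⟨y, rfl⟩ := Abelian.Ext.contravariant_sequence_exact₁ hS M x (n₁ := i + 1 + 1)
      (by omega) (Subsingleton.elim _ _)
    rw [Abelian.Ext.eq_zero_of_projective y, Abelian.Ext.comp_zero]

end Ext

end ProjRes

theorem HasDegreewiseFiniteProjRes.exists_projRes {T : Type u} [Ring T] {X : Type u}
    [AddCommGroup X] [Module T X] (h : HasDegreewiseFiniteProjRes T X) :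
    ∃ Q : ProjRes T X, Q.DegreewiseFinite := by
  obtain ⟨P, d, ε, hP, h₁, h₂, h₃⟩ := h
  exact ⟨⟨P, d, ε, fun i => (hP i).2, h₁, h₂, h₃⟩, ⟨fun i => (hP i).1⟩⟩

/-! ### Long exact sequences for the tensor product -/

section Chase

open BTensor

variable (S : Type u) [Ring S] {A B C : Type u} [AddCommGroup A] [Module S A] [AddCommGroup B]
  [Module S B] [AddCommGroup C] [Module S C] {f : A →ₗ[S] B} {g : B →ₗ[S] C}
  {W₀ W₁ W₂ W₃ : Type u} [AddCommGroup W₀] [Module Sᵐᵒᵖ W₀] [AddCommGroup W₁] [Module Sᵐᵒᵖ W₁]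
  [AddCommGroup W₂] [Module Sᵐᵒᵖ W₂] [AddCommGroup W₃] [Module Sᵐᵒᵖ W₃]
  {δ₁ : W₁ →ₗ[Sᵐᵒᵖ] W₀} {δ₂ : W₂ →ₗ[Sᵐᵒᵖ] W₁} {δ₃ : W₃ →ₗ[Sᵐᵒᵖ] W₂}

/-- This is the segment `H₂(B) → H₂(C) → H₁(A)` for the complex `W`. Injectivity is required only at
`W₀`, which lets `W₀` be the augmented module, not a term of its resolution. -/
theorem rTensor_exact_quotient (hg : Function.Surjective g) (hfg : Function.Exact f g)
    (h₁₂ : δ₁.comp δ₂ = 0) (h₂₃ : δ₂.comp δ₃ = 0)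
    (hW : Function.Injective (lMap S W₀ f))
    (hA : Function.Exact (rTensor S A δ₂) (rTensor S A δ₁))
    (hB : Function.Exact (rTensor S B δ₃) (rTensor S B δ₂)) :
    Function.Exact (rTensor S C δ₃) (rTensor S C δ₂) := by
  intro z
  refine ⟨fun hz => ?_, ?_⟩
  · obtain ⟨y, rfl⟩ := lMap_surjective S hg z
    obtain ⟨x, hx⟩ := (lMap_exact S hfg hg (rTensor S B δ₂ y)).1 (by rw [lMap_rTensor, hz])
    have hx' : rTensor S A δ₁ x = 0 := by
      apply hW
      rw [lMap_rTensor, hx, rTensor_rTensor, h₁₂, rTensor_zero, map_zero]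
    obtain ⟨x', rfl⟩ := (hA x).1 hx'
    obtain ⟨y', hy'⟩ := (hB (y - lMap S W₂ f x')).1
      (by rw [map_sub, ← lMap_rTensor, hx, sub_self])
    refine ⟨lMap S W₃ g y', ?_⟩
    rw [← lMap_rTensor, hy', map_sub, (lMap_exact S hfg hg).apply_apply_eq_zero, sub_zero]
  · rintro ⟨y, rfl⟩
    rw [rTensor_rTensor, h₂₃, rTensor_zero]

/-- This is the segment `H₂(C) → H₁(A) → H₁(B)`. -/
theorem rTensor_exact_sub (hg : Function.Surjective g) (hfg : Function.Exact f g)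
    (h₁₂ : δ₁.comp δ₂ = 0) (h₂₃ : δ₂.comp δ₃ = 0)
    (hW : Function.Injective (lMap S W₁ f))
    (hB : Function.Exact (rTensor S B δ₂) (rTensor S B δ₁))
    (hC : Function.Exact (rTensor S C δ₃) (rTensor S C δ₂)) :
    Function.Exact (rTensor S A δ₂) (rTensor S A δ₁) := by
  intro x
  refine ⟨fun hx => ?_, ?_⟩
  · obtain ⟨y, hy⟩ := (hB (lMap S W₁ f x)).1 (by rw [← lMap_rTensor, hx, map_zero])
    obtain ⟨z, hz⟩ := (hC (lMap S W₂ g y)).1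
      (by rw [← lMap_rTensor, hy, (lMap_exact S hfg hg).apply_apply_eq_zero])
    obtain ⟨z', rfl⟩ := lMap_surjective S hg z
    obtain ⟨x', hx'⟩ := (lMap_exact S hfg hg (y - rTensor S B δ₃ z')).1
      (by rw [map_sub, ← hz, lMap_rTensor, sub_self])
    refine ⟨x', hW ?_⟩
    rw [lMap_rTensor, hx', map_sub, hy, rTensor_rTensor, h₂₃, rTensor_zero, sub_zero]
  · rintro ⟨y, rfl⟩
    rw [rTensor_rTensor, h₁₂, rTensor_zero]

/-- This is the end of the sequence, `Tor₁(W₀, C) → W₀ ⊗ A → W₀ ⊗ B`, with `W₀` the module being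
resolved. -/
theorem lMap_injective_of_exact (hg : Function.Surjective g) (hfg : Function.Exact f g)
    (hδ : Function.Surjective δ₁) (h₁₂ : Function.Exact δ₂ δ₁) (h₂₃ : δ₂.comp δ₃ = 0)
    (hW : Function.Injective (lMap S W₁ f))
    (hC : Function.Exact (rTensor S C δ₃) (rTensor S C δ₂)) :
    Function.Injective (lMap S W₀ f) := by
  refine (injective_iff_map_eq_zero _).2 fun x hx => ?_
  obtain ⟨x, rfl⟩ := rTensor_surjective S hδ x
  obtain ⟨y, hy⟩ := (rTensor_exact S h₁₂ hδ (lMap S W₁ f x)).1 (by rw [← lMap_rTensor, hx])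
  obtain ⟨z, hz⟩ := (hC (lMap S W₂ g y)).1
    (by rw [← lMap_rTensor, hy, (lMap_exact S hfg hg).apply_apply_eq_zero])
  obtain ⟨z', rfl⟩ := lMap_surjective S hg z
  obtain ⟨x', hx'⟩ := (lMap_exact S hfg hg (y - rTensor S B δ₃ z')).1
    (by rw [map_sub, ← hz, lMap_rTensor, sub_self])
  have : rTensor S A δ₂ x' = x := by
    apply hW
    rw [lMap_rTensor, hx', map_sub, hy, rTensor_rTensor, h₂₃, rTensor_zero, sub_zero]
  rw [← this]
  exact (rTensor_exact S (N := A) h₁₂ hδ).apply_apply_eq_zero x'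

end Chase

/-! ### Vanishing of Tor via a finite resolution of the right module -/

namespace ProjRes

open BTensor

variable {S : Type u} [Ring S] {X : Type u} [AddCommGroup X] [Module Sᵐᵒᵖ X] (Q : ProjRes Sᵐᵒᵖ X)

/-- `Torᵢ₊₁(X, N) = 0`, expressed by the complex `P ⊗_S N`. -/
def TorVanishes (i : ℕ) (N : Type u) [AddCommGroup N] [Module S N] : Prop :=
  Function.Exact (rTensor S N (Q.d (i + 1))) (rTensor S N (Q.d i))

theorem torVanishes_of_isFlat (i : ℕ) {N : Type u} [AddCommGroup N] [Module S N]
    (hN : IsFlat S N) : Q.TorVanishes i N :=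
  hN.exact S (Q.exact_succ i)

theorem TorVanishes.of_equiv {i : ℕ} {A B : Type u} [AddCommGroup A] [Module S A]
    [AddCommGroup B] [Module S B] (e : A ≃ₗ[S] B) (hA : Q.TorVanishes i A) :
    Q.TorVanishes i B := by
  have h₁ : ∀ (j) (t : BTensor S (Q.P j) B),
      lMap S _ e.toLinearMap (lMap S _ e.symm.toLinearMap t) = t := fun j t => by
    rw [lMap_lMap]; simp
  intro t
  constructor
  · intro ht
    obtain ⟨s, hs⟩ := (hA (lMap S _ e.symm.toLinearMap t)).1 (by rw [← lMap_rTensor, ht, map_zero])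
    exact ⟨lMap S _ e.toLinearMap s, by rw [← lMap_rTensor, hs, h₁]⟩
  · rintro ⟨s, rfl⟩
    rw [rTensor_rTensor, Q.d_comp_d, rTensor_zero]

section

variable {A B C : Type u} [AddCommGroup A] [Module S A] [AddCommGroup B] [Module S B]
  [AddCommGroup C] [Module S C] {f : A →ₗ[S] B} {g : B →ₗ[S] C} [Q.DegreewiseFinite]
  (hf : Function.Injective f) (hg : Function.Surjective g) (hfg : Function.Exact f g)
include hf hg hfg

theorem TorVanishes.of_shortExact {i : ℕ} (hB : Q.TorVanishes i B)
    (hC : Q.TorVanishes (i + 1) C) : Q.TorVanishes i A :=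
  rTensor_exact_sub S hg hfg (Q.d_comp_d i) (Q.d_comp_d (i + 1)) (lMap_injective S hf) hB hC

theorem TorVanishes.lMap_injective (hC : Q.TorVanishes 0 C) :
    Function.Injective (lMap S X f) :=
  lMap_injective_of_exact S hg hfg Q.surjective Q.exact_zero (Q.d_comp_d 0)
    (BTensor.lMap_injective S hf) hC

end

/-- Vanishing of `Tor` computed by a projective resolution in the second variable implies its
vanishing computed in the first one. -/
theorem torVanishes_of_exact_lMap [Q.DegreewiseFinite] (i : ℕ) :
    ∀ {N : Type u} [AddCommGroup N] [Module S N] (W : ProjRes S N),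
      Function.Exact (lMap S X (W.d (i + 1))) (lMap S X (W.d i)) → Q.TorVanishes i N := by
  have hker : ∀ {N : Type u} [AddCommGroup N] [Module S N] (W : ProjRes S N),
      Function.Exact (LinearMap.ker W.ε).subtype W.ε := fun W x => by simp
  induction i with
  | zero =>
    intro N _ _ W h
    -- Here the augmentation plays the role of `δ₁`, with `W₀ = X`. What remains is injectivity of
    -- `X ⊗ ker ε → X ⊗ W.P 0`: an element lifts to `X ⊗ W.P 1`, and by `h` the lift comes from `X ⊗
    -- W.P 2`, which dies in `X ⊗ ker ε`.
    refine rTensor_exact_quotient S W.surjective (hker W) Q.ε_comp_d (Q.d_comp_d 0) ?_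
      (rTensor_exact S Q.exact_zero Q.surjective)
      (Q.torVanishes_of_isFlat 0 (IsFlat.of_projective S))
    refine (injective_iff_map_eq_zero _).2 fun t ht => ?_
    obtain ⟨t, rfl⟩ := lMap_surjective S W.shift.surjective t
    rw [lMap_lMap] at ht
    obtain ⟨u, rfl⟩ := (h t).1 ht
    refine (lMap_lMap S (A := X) (W.shift.d 0) W.shift.ε u).trans ?_
    rw [W.shift.ε_comp_d]
    exact lMap_zero S u
  | succ i ih =>
    intro N _ _ W h
    exact rTensor_exact_quotient S W.surjective (hker W) (Q.d_comp_d i) (Q.d_comp_d (i + 1))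
      (BTensor.lMap_injective S (Submodule.subtype_injective _)) (ih W.shift h)
      (Q.torVanishes_of_isFlat (i + 1) (IsFlat.of_projective S))

end ProjRes

/-! ### Comparison with the derived functor `tor` -/

section Tor

variable (R S : Type u) [Ring R] [Ring S] (ω : Type u) [AddCommGroup ω] [Module R ω]
  [Module Sᵐᵒᵖ ω] [SMulCommClass R Sᵐᵒᵖ ω]

/-- The sequence of modules underlying a categorical projective resolution. -/
def ProjRes.ofProjectiveResolution {N : ModuleCat.{u} S} (W : ProjectiveResolution N) :
    ProjRes S N where
  P := W.complex.X
  d i := (W.complex.d (i + 1) i).hom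
  ε := (W.π.f 0).hom
  projective i := (IsProjective.iff_projective _).2 (W.projective i)
  surjective := (ModuleCat.epi_iff_surjective (W.π.f 0)).1 inferInstance
  exact_zero := by
    have h := ShortComplex.exact_of_g_is_cokernel
      (ShortComplex.mk _ _ W.complex_d_comp_π_f_zero) W.isColimitCokernelCofork
    exact (ShortComplex.ShortExact.moduleCat_exact_iff_function_exact _).1 h
  exact_succ i := (ShortComplex.ShortExact.moduleCat_exact_iff_function_exact _).1 (W.exact_succ i)

/-- Balancing of Tor: `tor` resolves `N`, whereas the semidualizing axioms give information on
resolutions of `ω`. -/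
theorem torVanishes_of_isZero_tor (Q : ProjRes Sᵐᵒᵖ ω) [Q.DegreewiseFinite] (i : ℕ)
    (N : ModuleCat.{u} S) (h : Limits.IsZero (tor R S ω (i + 1) N)) : Q.TorVanishes i N := by
  let W := projectiveResolution N
  refine Q.torVanishes_of_exact_lMap i (ProjRes.ofProjectiveResolution S W) ?_
  have h₁ := h.of_iso (W.isoLeftDerivedObj (tensorFunctor R S ω) (i + 1)).symm
  have h₂ := (HomologicalComplex.exactAt_iff_isZero_homology _ _).2 h₁
  rw [HomologicalComplex.exactAt_iff' _ (i + 2) (i + 1) i (by simp) (by simp)] at h₂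
  exact (ShortComplex.ShortExact.moduleCat_exact_iff_function_exact _).1 h₂

end Tor

/-! ### Induction on the length of a resolution -/

section Resolution

variable {T : Type u} [Ring T] {𝒳 : ModuleCat.{u} T → Prop}

theorem exact_comp_of_surjective {A B C D : Type u} [AddCommGroup A] [Module T A] [AddCommGroup B]
    [Module T B] [AddCommGroup C] [Module T C] [AddCommGroup D] [Module T D] {e : A →ₗ[T] B}
    {f : B →ₗ[T] C} {g : C →ₗ[T] D} (he : Function.Surjective e) (h : Function.Exact f g) :
    Function.Exact (f.comp e) g := fun c => by
  rw [h c]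
  exact ⟨fun ⟨b, hb⟩ => (he b).imp fun a ha => by rw [LinearMap.comp_apply, ha, hb],
    fun ⟨a, ha⟩ => ⟨e a, ha⟩⟩

theorem exact_comp_of_injective {A B C D : Type u} [AddCommGroup A] [Module T A] [AddCommGroup B]
    [Module T B] [AddCommGroup C] [Module T C] [AddCommGroup D] [Module T D] {f : A →ₗ[T] B}
    {g : B →ₗ[T] C} {m : C →ₗ[T] D} (hm : Function.Injective m) (h : Function.Exact f g) :
    Function.Exact f (m.comp g) := fun b => by
  rw [← h b, LinearMap.comp_apply, map_eq_zero_iff m hm]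

theorem HasResolution.of_equiv {M M' : ModuleCat.{u} T} {n : ℕ} (e : M ≃ₗ[T] M')
    (h : HasResolution 𝒳 M n) : HasResolution 𝒳 M' n := by
  obtain ⟨X, d, ε, h₁, h₂, h₃, h₄, h₅⟩ := h
  exact ⟨X, d, e.toLinearMap.comp ε, h₁, h₂, e.surjective.comp h₃,
    exact_comp_of_injective e.injective h₄, h₅⟩

theorem HasCoresolution.of_equiv {M M' : ModuleCat.{u} T} {n : ℕ} (e : M ≃ₗ[T] M')
    (h : HasCoresolution 𝒳 M n) : HasCoresolution 𝒳 M' n := by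
  obtain ⟨X, d, η, h₁, h₂, h₃, h₄, h₅⟩ := h
  exact ⟨X, d, η.comp e.symm.toLinearMap, h₁, h₂, h₃.comp e.symm.injective,
    exact_comp_of_surjective e.symm.surjective h₄, h₅⟩

theorem hasResolution_zero_iff {M : ModuleCat.{u} T} :
    HasResolution 𝒳 M 0 ↔ ∃ X : ModuleCat.{u} T, 𝒳 X ∧ Nonempty (X ≃ₗ[T] M) := by
  constructor
  · rintro ⟨X, d, ε, h₁, h₂, h₃, h₄, h₅⟩
    refine ⟨X 0, h₁ 0 le_rfl, ⟨LinearEquiv.ofBijective ε ⟨?_, h₃⟩⟩⟩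
    refine (injective_iff_map_eq_zero _).2 fun x hx => ?_
    obtain ⟨y, rfl⟩ := (h₄ x).1 hx
    have := h₂ 1 one_pos
    rw [Subsingleton.elim y 0, map_zero]
  · rintro ⟨X, hX, ⟨e⟩⟩
    refine ⟨fun i => Nat.casesOn i X fun _ => ModuleCat.of T PUnit, fun i => 0, e.toLinearMap,
      ?_, ?_, e.surjective, ?_, ?_⟩
    · intro i hi
      obtain rfl : i = 0 := by omega
      exact hX
    · rintro (_ | i) hi
      · exact absurd hi (lt_irrefl _)
      · exact inferInstanceAs (Subsingleton PUnit)
    · intro x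
      refine ⟨fun hx => ⟨0, ?_⟩, ?_⟩
      · rw [map_zero]
        exact ((map_eq_zero_iff e.toLinearMap e.injective).1 hx).symm
      · rintro ⟨y, rfl⟩
        exact map_zero _
    · intro i x
      exact ⟨fun _ => ⟨0, Subsingleton.elim (α := PUnit) _ _⟩, fun _ => rfl⟩

theorem hasCoresolution_zero_iff {M : ModuleCat.{u} T} :
    HasCoresolution 𝒳 M 0 ↔ ∃ X : ModuleCat.{u} T, 𝒳 X ∧ Nonempty (X ≃ₗ[T] M) := by
  constructor
  · rintro ⟨X, d, η, h₁, h₂, h₃, h₄, h₅⟩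
    refine ⟨X 0, h₁ 0 le_rfl, ⟨(LinearEquiv.ofBijective η ⟨h₃, fun x => ?_⟩).symm⟩⟩
    have := h₂ 1 one_pos
    exact (h₄ x).1 (Subsingleton.elim _ _)
  · rintro ⟨X, hX, ⟨e⟩⟩
    refine ⟨fun i => Nat.casesOn i X fun _ => ModuleCat.of T PUnit, fun i => 0,
      e.symm.toLinearMap, ?_, ?_, e.symm.injective, ?_, ?_⟩
    · intro i hi
      obtain rfl : i = 0 := by omega
      exact hX
    · rintro (_ | i) hi
      · exact absurd hi (lt_irrefl _)
      · exact inferInstanceAs (Subsingleton PUnit)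
    · intro x
      exact ⟨fun hx => e.symm.surjective x, fun _ => rfl⟩
    · intro i x
      exact ⟨fun _ => ⟨0, Subsingleton.elim (α := PUnit) _ _⟩, fun _ => rfl⟩

/-- Cutting at the first syzygy, and splicing back, reduces every transport of resolutions to one
short exact sequence. -/
theorem hasResolution_succ_iff {M : ModuleCat.{u} T} {n : ℕ} :
    HasResolution 𝒳 M (n + 1) ↔ ∃ (K X : ModuleCat.{u} T) (f : K →ₗ[T] X) (g : X →ₗ[T] M),
      𝒳 X ∧ HasResolution 𝒳 K n ∧ Function.Injective f ∧ Function.Surjective g ∧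
        Function.Exact f g := by
  constructor
  · rintro ⟨X, d, ε, h₁, h₂, h₃, h₄, h₅⟩
    refine ⟨ModuleCat.of T (LinearMap.ker ε), X 0, (LinearMap.ker ε).subtype, ε,
      h₁ 0 (Nat.zero_le _), ⟨fun i => X (i + 1), fun i => d (i + 1),
        (d 0).codRestrict _ h₄.apply_apply_eq_zero, fun i hi => h₁ _ (Nat.succ_le_succ hi),
        fun i hi => h₂ _ (Nat.succ_lt_succ hi), ?_, ?_, fun i => h₅ (i + 1)⟩,
      Submodule.subtype_injective _, h₃, fun x => by simp⟩
    · rintro ⟨x, hx⟩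
      obtain ⟨y, rfl⟩ := (h₄ x).1 hx
      exact ⟨y, rfl⟩
    · intro y
      rw [← h₅ 0 y]
      exact Subtype.coe_inj (b := (0 : LinearMap.ker ε)).symm
  · rintro ⟨K, X, f, g, hX, ⟨Y, d, ε, h₁, h₂, h₃, h₄, h₅⟩, hf, hg, hfg⟩
    refine ⟨fun i => Nat.casesOn i X Y, fun i => match i with
      | 0 => f.comp ε
      | i + 1 => d i, g, ?_, ?_, hg, exact_comp_of_surjective h₃ hfg, ?_⟩
    · rintro (_ | i) hi
      · exact hX
      · exact h₁ i (Nat.le_of_succ_le_succ hi)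
    · rintro (_ | i) hi
      · exact absurd hi (Nat.not_lt_zero _)
      · exact h₂ i (Nat.lt_of_succ_lt_succ hi)
    · rintro (_ | i)
      · exact exact_comp_of_injective hf h₄
      · exact h₅ i

theorem hasCoresolution_succ_iff {M : ModuleCat.{u} T} {n : ℕ} :
    HasCoresolution 𝒳 M (n + 1) ↔ ∃ (X K : ModuleCat.{u} T) (f : M →ₗ[T] X) (g : X →ₗ[T] K),
      𝒳 X ∧ HasCoresolution 𝒳 K n ∧ Function.Injective f ∧ Function.Surjective g ∧
        Function.Exact f g := by
  constructor
  · rintro ⟨X, d, η, h₁, h₂, h₃, h₄, h₅⟩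
    refine ⟨X 0, ModuleCat.of T (LinearMap.range (d 0)), η, (d 0).rangeRestrict,
      h₁ 0 (Nat.zero_le _), ⟨fun i => X (i + 1), fun i => d (i + 1),
        (LinearMap.range (d 0)).subtype, fun i hi => h₁ _ (Nat.succ_le_succ hi),
        fun i hi => h₂ _ (Nat.succ_lt_succ hi), Submodule.subtype_injective _, ?_,
        fun i => h₅ (i + 1)⟩, h₃, (d 0).surjective_rangeRestrict, fun x => ?_⟩
    · intro x
      rw [h₅ 0 x]
      exact ⟨fun h => ⟨⟨x, h⟩, rfl⟩, fun ⟨y, hy⟩ => hy ▸ y.2⟩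
    · rw [← h₄ x]
      exact Subtype.coe_inj (b := (0 : LinearMap.range (d 0))).symm
  · rintro ⟨X, K, f, g, hX, ⟨Y, d, η, h₁, h₂, h₃, h₄, h₅⟩, hf, hg, hfg⟩
    refine ⟨fun i => Nat.casesOn i X Y, fun i => match i with
      | 0 => η.comp g
      | i + 1 => d i, f, ?_, ?_, hf, exact_comp_of_injective h₃ hfg, ?_⟩
    · rintro (_ | i) hi
      · exact hX
      · exact h₁ i (Nat.le_of_succ_le_succ hi)
    · rintro (_ | i) hi
      · exact absurd hi (Nat.not_lt_zero _)
      · exact h₂ i (Nat.lt_of_succ_lt_succ hi)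
    · rintro (_ | i)
      · exact exact_comp_of_surjective hg h₄
      · exact h₅ i

/-- Dimension at most `n` is encoded as dimension less than `n + 1`. Both sides drop by one on
passing to a syzygy; a free cover supplies one when none is given. -/
theorem hasResolution_projective_iff {n : ℕ} {M : ModuleCat.{u} T} :
    HasResolution (fun P : ModuleCat.{u} T => Module.Projective T P) M n ↔
      HasProjectiveDimensionLT M (n + 1) := by
  induction n generalizing M with
  | zero =>
    rw [hasResolution_zero_iff, zero_add, ← projective_iff_hasProjectiveDimensionLT_one]
    constructor
    · rintro ⟨X, hX, ⟨e⟩⟩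
      exact (IsProjective.iff_projective _).1 (Module.Projective.of_equiv' e)
    · exact fun h => ⟨M, (IsProjective.iff_projective _).2 h, ⟨LinearEquiv.refl T M⟩⟩
  | succ n ih =>
    rw [hasResolution_succ_iff]
    constructor
    · rintro ⟨K, X, f, g, hX, hK, hf, hg, hfg⟩
      have hS := ModuleCat.shortComplex_shortExact
        (ModuleCat.shortComplexOfCompEqZero f g (LinearMap.ext hfg.apply_apply_eq_zero)) hfg hf hg
      exact (hS.hasProjectiveDimensionLT_X₃_iff n ((IsProjective.iff_projective _).1 hX)).2
        (ih.1 hK)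
    · intro h
      have hS := M.shortExact_projectiveShortComplex
      refine ⟨_, _, M.projectiveShortComplex.f.hom, M.projectiveShortComplex.g.hom,
        Module.Projective.of_free, ih.2 ?_, (ModuleCat.mono_iff_injective _).1 hS.mono_f,
        (ModuleCat.epi_iff_surjective _).1 hS.epi_g,
        (ShortComplex.ShortExact.moduleCat_exact_iff_function_exact _).1 hS.exact⟩
      exact (hS.hasProjectiveDimensionLT_X₃_iff n
        ((IsProjective.iff_projective _).1 Module.Projective.of_free)).1 h

theorem hasCoresolution_injective_iff {n : ℕ} {M : ModuleCat.{u} T} :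
    HasCoresolution (fun I : ModuleCat.{u} T => Module.Injective T I) M n ↔
      HasInjectiveDimensionLT M (n + 1) := by
  induction n generalizing M with
  | zero =>
    rw [hasCoresolution_zero_iff, zero_add, ← injective_iff_hasInjectiveDimensionLT_one]
    constructor
    · rintro ⟨X, hX, ⟨e⟩⟩
      have := (Module.injective_iff_injective_object T X).1 hX
      exact Injective.of_iso e.toModuleIso this
    · exact fun h => ⟨M, (Module.injective_iff_injective_object T M).2 h, ⟨LinearEquiv.refl T M⟩⟩
  | succ n ih =>
    rw [hasCoresolution_succ_iff]
    constructor
    · rintro ⟨X, K, f, g, hX, hK, hf, hg, hfg⟩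
      have hS := ModuleCat.shortComplex_shortExact
        (ModuleCat.shortComplexOfCompEqZero f g (LinearMap.ext hfg.apply_apply_eq_zero)) hfg hf hg
      exact (hS.hasInjectiveDimensionLT_X₃_iff n
        ((Module.injective_iff_injective_object T X).1 hX)).1 (ih.1 hK)
    · intro h
      let ι := (Injective.ι M).hom
      have hι : Function.Injective ι := (ModuleCat.mono_iff_injective (Injective.ι M)).1 inferInstance
      have hfg : Function.Exact ι (LinearMap.range ι).mkQ := fun x => by simp
      have hS := ModuleCat.shortComplex_shortExact
        (ModuleCat.shortComplexOfCompEqZero ι (LinearMap.range ι).mkQ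
          (LinearMap.ext hfg.apply_apply_eq_zero)) hfg hι (Submodule.mkQ_surjective _)
      have hI : Injective (Injective.under M) := inferInstance
      exact ⟨Injective.under M, ModuleCat.of T (_ ⧸ LinearMap.range ι), ι, (LinearMap.range ι).mkQ,
        (Module.injective_iff_injective_object T _).2 hI,
        ih.2 ((hS.hasInjectiveDimensionLT_X₃_iff n hI).2 h), hι, Submodule.mkQ_surjective _, hfg⟩

theorem relProjDim_le_of_forall {U : Type u} [Ring U] {𝒴 : ModuleCat.{u} U → Prop}
    {M : ModuleCat.{u} T} {N : ModuleCat.{u} U}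
    (h : ∀ n, HasResolution 𝒴 N n → HasResolution 𝒳 M n) :
    relProjDim 𝒳 M ≤ relProjDim 𝒴 N :=
  le_iInf₂ fun n hn => iInf₂_le n (h n hn)

theorem relInjDim_le_of_forall {U : Type u} [Ring U] {𝒴 : ModuleCat.{u} U → Prop}
    {M : ModuleCat.{u} T} {N : ModuleCat.{u} U}
    (h : ∀ n, HasCoresolution 𝒴 N n → HasCoresolution 𝒳 M n) :
    relInjDim 𝒳 M ≤ relInjDim 𝒴 N :=
  le_iInf₂ fun n hn => iInf₂_le n (h n hn)

/-- Natural upper bounds do not distinguish `⊥` from `0`, so the zero module needs no separate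
treatment. -/
theorem unbotD_zero_eq_iInf {a : WithBot ℕ∞} {p : ℕ → Prop} (h : ∀ n : ℕ, p n ↔ a ≤ n) :
    a.unbotD 0 = ⨅ (n : ℕ) (_ : p n), (n : ℕ∞) := by
  have key : ∀ n : ℕ, p n ↔ a.unbotD 0 ≤ n := fun n => by
    rw [h n]
    induction a with
    | bot => simp
    | coe a =>
      rw [WithBot.unbotD_coe]
      exact_mod_cast Iff.rfl
  refine le_antisymm (le_iInf₂ fun n hn => (key n).1 hn) ?_
  generalize a.unbotD 0 = b at key
  induction b with
  | top => exact le_top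
  | coe b => exact iInf₂_le b ((key b).2 le_rfl)

theorem projDim_eq_relProjDim (M : ModuleCat.{u} T) :
    projDim M = relProjDim (fun P : ModuleCat.{u} T => Module.Projective T P) M :=
  unbotD_zero_eq_iInf fun n =>
    hasResolution_projective_iff.trans (projectiveDimension_le_iff M n).symm

theorem injDim_eq_relInjDim (M : ModuleCat.{u} T) :
    injDim M = relInjDim (fun I : ModuleCat.{u} T => Module.Injective T I) M :=
  unbotD_zero_eq_iInf fun n =>
    hasCoresolution_injective_iff.trans (injectiveDimension_le_iff M n).symm

end Resolution

open BTensor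

/-! ### The complex `Hom(P, ω)` -/

section Precomp

variable {R : Type u} [Ring R] (T : Type u) [Ring T] {ω : Type u} [AddCommGroup ω] [Module R ω]
  [Module T ω] [SMulCommClass R T ω]

variable (ω) in
/-- `Hom_R(d, ω)`, as a map of modules over a ring `T` acting on `ω`. -/
def precomp {P P' : Type u} [AddCommGroup P] [Module R P] [AddCommGroup P'] [Module R P']
    (d : P' →ₗ[R] P) : (P →ₗ[R] ω) →ₗ[T] (P' →ₗ[R] ω) where
  toFun f := f.comp d
  map_add' _ _ := rfl
  map_smul' _ _ := rfl

@[simp] theorem precomp_apply {P P' : Type u} [AddCommGroup P] [Module R P] [AddCommGroup P']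
    [Module R P'] (d : P' →ₗ[R] P) (f : P →ₗ[R] ω) : precomp T ω d f = f.comp d :=
  rfl

/-- Together with the next two lemmas this gives the exact coresolution `0 → T → Hom(P₀, ω) →
Hom(P₁, ω) → ⋯`. It is used with `T = Sᵐᵒᵖ` over `R`, and with `T = R` over `Sᵐᵒᵖ`. -/
theorem ProjRes.ExtVanishes.exact_precomp {X : Type u} [AddCommGroup X] [Module R X]
    (Q : ProjRes R X) {i : ℕ} (h : Q.ExtVanishes i ω) :
    Function.Exact (precomp T ω (Q.d i)) (precomp T ω (Q.d (i + 1))) := by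
  intro f
  refine ⟨h f, ?_⟩
  rintro ⟨g, rfl⟩
  rw [precomp_apply, precomp_apply, LinearMap.comp_assoc, Q.d_comp_d, LinearMap.comp_zero]

variable (Q : ProjRes R ω)

theorem ProjRes.toSpanSingleton_ε_injective (h : ∀ t : T, (∀ x : ω, t • x = 0) → t = 0) :
    Function.Injective (LinearMap.toSpanSingleton T (Q.P 0 →ₗ[R] ω) Q.ε) := by
  refine (injective_iff_map_eq_zero _).2 fun t ht => h t fun x => ?_
  obtain ⟨p, rfl⟩ := Q.surjective x
  exact LinearMap.congr_fun ht p

/-- The kernel of `Hom(d₀, ω)` is `Hom(ω, ω)`, and every endomorphism is multiplication by some `t`.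
-/
theorem ProjRes.exact_toSpanSingleton_ε (h : ∀ g : ω →ₗ[R] ω, ∃ t : T, ∀ x, t • x = g x) :
    Function.Exact (LinearMap.toSpanSingleton T (Q.P 0 →ₗ[R] ω) Q.ε) (precomp T ω (Q.d 0)) := by
  intro f
  constructor
  · intro hf
    obtain ⟨g, rfl⟩ := Q.exists_factor_augmentation f hf
    obtain ⟨t, ht⟩ := h g
    exact ⟨t, LinearMap.ext fun p => ht (Q.ε p)⟩
  · rintro ⟨t, rfl⟩
    ext x
    have : Q.ε (Q.d 0 x) = 0 := Q.exact_zero.apply_apply_eq_zero x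
    simp [this]

end Precomp

theorem tmul_one_contract (S : Type u) [Ring S] {F : Type u} [AddCommGroup F] [Module S F]
    (t : BTensor S Sᵐᵒᵖ F) : tmul S (1 : Sᵐᵒᵖ) (contract S LinearMap.id t) = t := by
  induction t using induction_on with
  | zero => simp
  | tmul a y =>
    rw [contract_tmul, ← smul_tmul]
    simp
  | add t t' h h' => rw [map_add, tmul_add, h, h']

section Bimodule

variable (R S : Type u) [Ring R] [Ring S] (ω : Type u) [AddCommGroup ω] [Module R ω]
  [Module Sᵐᵒᵖ ω] [SMulCommClass R Sᵐᵒᵖ ω]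

/-! ### Tensor evaluation -/

section HomTensor

variable (P F : Type u) [AddCommGroup P] [Module R P] [AddCommGroup F] [Module S F]

/-- The map `Hom_R(P, ω) ⊗_S F → Hom_R(P, ω ⊗_S F)`, `f ⊗ y ↦ (p ↦ f(p) ⊗ y)`. -/
def homTensor : BTensor S (P →ₗ[R] ω) F →+ (P →ₗ[R] BTensor S ω F) :=
  lift S
    (AddMonoidHom.mk' (fun f => AddMonoidHom.mk' (fun y => (tmulRight R S ω y).comp f)
      (fun y y' => LinearMap.ext fun p => tmul_add S (f p) y y'))
      (fun f f' => by
        ext y p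
        exact add_tmul S (f p) (f' p) y))
    (fun f s y => LinearMap.ext fun p => smul_tmul S (f p) s y)

variable {P F}

@[simp] theorem homTensor_tmul (f : P →ₗ[R] ω) (y : F) (p : P) :
    homTensor R S ω P F (tmul S f y) p = tmul S (f p) y :=
  rfl

theorem homTensor_precomp {P' : Type u} [AddCommGroup P'] [Module R P'] (d : P' →ₗ[R] P)
    (t : BTensor S (P →ₗ[R] ω) F) :
    homTensor R S ω P' F (rTensor S F (precomp Sᵐᵒᵖ ω d) t) = (homTensor R S ω P F t).comp d := by
  induction t using induction_on with
  | zero => simp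
  | tmul f y => rw [rTensor_tmul]; rfl
  | add t t' h h' => simp only [map_add, h, h', LinearMap.add_comp]

/-- With a dual basis `(xᵢ, φᵢ)`, the inverse sends `k` to `∑ φᵢ(-) k(xᵢ)`; `ψ i` is the map `w ↦
φᵢ(-) w`. -/
theorem homTensor_bijective [Module.Finite R P] [Module.Projective R P] :
    Function.Bijective (homTensor R S ω P F) := by
  obtain ⟨n, x, φ, h⟩ := exists_finite_dual_basis R P
  let ψ : Fin n → ω →ₗ[Sᵐᵒᵖ] (P →ₗ[R] ω) := fun i =>
    { toFun := fun w => (LinearMap.toSpanSingleton R ω w).comp (φ i)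
      map_add' := fun w w' => by ext p; simp
      map_smul' := fun s w => by
        ext p
        exact smul_comm (φ i p) s w }
  have hψ : ∀ (i) (t : BTensor S ω F) (p : P),
      homTensor R S ω P F (rTensor S F (ψ i) t) p = φ i p • t := by
    intro i t p
    induction t using induction_on with
    | zero => simp
    | tmul w y => rw [rTensor_tmul, homTensor_tmul, smul_tmul_left]; rfl
    | add t t' h h' => rw [map_add, map_add, LinearMap.add_apply, h, h', smul_add]
  constructor
  · refine Function.LeftInverse.injective
      (g := fun k : P →ₗ[R] BTensor S ω F => ∑ i, rTensor S F (ψ i) (k (x i))) fun t => ?_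
    induction t using induction_on with
    | zero => simp
    | tmul f y =>
      simp only [homTensor_tmul, rTensor_tmul, ← sum_tmul]
      congr 1
      ext p
      conv_rhs => rw [← h p, map_sum]
      simp [ψ]
    | add t t' h h' =>
      simp only [map_add, LinearMap.add_apply, Finset.sum_add_distrib]
      exact congrArg₂ (· + ·) h h'
  · intro k
    refine ⟨∑ i, rTensor S F (ψ i) (k (x i)), LinearMap.ext fun p => ?_⟩
    rw [map_sum, LinearMap.sum_apply]
    simp only [hψ]
    conv_rhs => rw [← h p, map_sum]
    simp

end HomTensor

/-! ### Flat modules: Ext vanishing and the unit -/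

section Flat

variable {R S ω} (Q : ProjRes R ω) [Q.DegreewiseFinite] {F : Type u} [AddCommGroup F] [Module S F]
  (hF : IsFlat S F)
include Q hF

/-- `Hom(P, ω ⊗ F)` is `Hom(P, ω) ⊗ F`, and tensoring with the flat module `F` keeps `Hom(P, ω)`
exact. -/
theorem extVanishes_tensor_of_isFlat {i : ℕ} (h : Q.ExtVanishes i ω) :
    Q.ExtVanishes i (BTensor S ω F) := by
  intro f hf
  obtain ⟨t, rfl⟩ := (homTensor_bijective R S ω).2 f
  rw [← homTensor_precomp] at hf
  obtain ⟨t', rfl⟩ := (hF.exact S (h.exact_precomp Sᵐᵒᵖ Q) t).1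
    ((injective_iff_map_eq_zero _).1 (homTensor_bijective R S ω).1 _ hf)
  exact ⟨homTensor R S ω _ F t', (homTensor_precomp R S ω _ t').symm⟩

/-- Tensoring `0 → S → Hom(P₀, ω) → Hom(P₁, ω)` with `F` exhibits `F` as the kernel of `Hom(P₀, ω ⊗
F) → Hom(P₁, ω ⊗ F)`. That kernel is also `Hom(ω, ω ⊗ F)`. -/
theorem unitMap_bijective_of_isFlat
    (h : Function.Bijective (fun s : S => rightMul R S ω s)) :
    Function.Bijective (unitMap R S ω F) := by
  let α := LinearMap.toSpanSingleton Sᵐᵒᵖ (Q.P 0 →ₗ[R] ω) Q.ε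
  have hα : Function.Injective α := Q.toSpanSingleton_ε_injective Sᵐᵒᵖ fun t ht => by
    have h0 : rightMul R S ω t.unop = rightMul R S ω 0 := LinearMap.ext fun x => by
      exact (ht x).trans (zero_smul Sᵐᵒᵖ x).symm
    exact MulOpposite.unop_injective (h.1 h0)
  have hex : Function.Exact α (precomp Sᵐᵒᵖ ω (Q.d 0)) :=
    Q.exact_toSpanSingleton_ε Sᵐᵒᵖ fun g => by
      obtain ⟨s, hs⟩ := h.2 g
      exact ⟨MulOpposite.op s, fun x => LinearMap.congr_fun hs x⟩
  have hε : ∀ y : F, rTensor S F α (tmul S (1 : Sᵐᵒᵖ) y) = tmul S Q.ε y := fun y => by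
    rw [rTensor_tmul, LinearMap.toSpanSingleton_apply, one_smul]
  constructor
  · refine (injective_iff_map_eq_zero _).2 fun y hy => ?_
    have h₁ : homTensor R S ω _ F (tmul S Q.ε y) = 0 :=
      LinearMap.ext fun p => LinearMap.congr_fun hy (Q.ε p)
    have h₂ := (injective_iff_map_eq_zero _).1 (homTensor_bijective R S ω).1 _ h₁
    rw [← hε] at h₂
    have h₃ := (injective_iff_map_eq_zero _).1 (hF _ _ α hα) _ h₂
    have h₄ := congrArg (contract S LinearMap.id) h₃
    simpa using h₄
  · intro k
    let k' : ω →ₗ[R] BTensor S ω F := k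
    obtain ⟨t, ht⟩ := (homTensor_bijective R S ω).2 (k'.comp Q.ε)
    obtain ⟨t', rfl⟩ := (hF.exact S hex t).1 (by
      apply (homTensor_bijective R S ω).1
      rw [homTensor_precomp, ht, LinearMap.comp_assoc, Q.ε_comp_d, LinearMap.comp_zero, map_zero])
    have h1 := tmul_one_contract S t'
    refine ⟨contract S LinearMap.id t', LinearMap.ext fun x => ?_⟩
    obtain ⟨p, rfl⟩ := Q.surjective x
    rw [← h1, hε] at ht
    exact LinearMap.congr_fun ht p

end Flat

/-! ### Homomorphism evaluation -/

section TensorHom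

variable [SMulCommClass Sᵐᵒᵖ R ω] (P I : Type u) [AddCommGroup P] [Module Sᵐᵒᵖ P] [AddCommGroup I]
  [Module R I]

variable {P} in
/-- Evaluation at `p`, an `R`-linear map `Hom_{Sᵒᵖ}(P, ω) → ω`. -/
def evalAt (p : P) : (P →ₗ[Sᵐᵒᵖ] ω) →ₗ[R] ω where
  toFun h := h p
  map_add' _ _ := rfl
  map_smul' _ _ := rfl

/-- The map `P ⊗_S Hom_R(ω, I) → Hom_R(Hom_{Sᵒᵖ}(P, ω), I)`, `p ⊗ f ↦ (h ↦ f(h(p)))`. -/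
def tensorHom : BTensor S P (HomFrom R S ω I) →+ ((P →ₗ[Sᵐᵒᵖ] ω) →ₗ[R] I) :=
  lift S
    (AddMonoidHom.mk' (fun p => AddMonoidHom.mk'
      (fun f : HomFrom R S ω I => LinearMap.comp (show ω →ₗ[R] I from f) (evalAt R S ω p))
      (fun _ _ => rfl))
      (fun p p' => by
        ext f h
        exact (congrArg (show ω →ₗ[R] I from f) (map_add h p p')).trans
          (map_add (show ω →ₗ[R] I from f) _ _)))
    (fun p s f => LinearMap.ext fun h =>
      congrArg (show ω →ₗ[R] I from f) (map_smul h (MulOpposite.op s) p))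

variable {P I}

theorem tensorHom_rTensor {P' : Type u} [AddCommGroup P'] [Module Sᵐᵒᵖ P'] (d : P' →ₗ[Sᵐᵒᵖ] P)
    (t : BTensor S P' (HomFrom R S ω I)) :
    tensorHom R S ω P I (rTensor S _ d t) = (tensorHom R S ω P' I t).comp (precomp R ω d) := by
  induction t using induction_on with
  | zero => simp
  | tmul f y => rw [rTensor_tmul]; rfl
  | add t t' h h' => simp only [map_add, h, h', LinearMap.add_comp]

/-- With a dual basis `(xᵢ, φᵢ)`, the inverse is `G ↦ ∑ xᵢ ⊗ (w ↦ G (φᵢ(-) w))`. -/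
theorem tensorHom_bijective [Module.Finite Sᵐᵒᵖ P] [Module.Projective Sᵐᵒᵖ P] :
    Function.Bijective (tensorHom R S ω P I) := by
  obtain ⟨n, x, φ, h⟩ := exists_finite_dual_basis Sᵐᵒᵖ P
  let ψ : Fin n → ω →ₗ[R] (P →ₗ[Sᵐᵒᵖ] ω) := fun i =>
    { toFun := fun w => (LinearMap.toSpanSingleton Sᵐᵒᵖ ω w).comp (φ i)
      map_add' := fun w w' => by ext p; simp
      map_smul' := fun s w => by
        ext p
        exact smul_comm (φ i p) s w }
  have hψ : ∀ k : P →ₗ[Sᵐᵒᵖ] ω, ∑ i, ψ i (k (x i)) = k := fun k => by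
    ext p
    conv_rhs => rw [← h p, map_sum]
    simp [ψ]
  let inv : ((P →ₗ[Sᵐᵒᵖ] ω) →ₗ[R] I) → Fin n → HomFrom R S ω I := fun G i => G.comp (ψ i)
  have inv_add : ∀ G G' i, inv (G + G') i = inv G i + inv G' i := fun _ _ _ => rfl
  constructor
  · refine Function.LeftInverse.injective
      (g := fun G => ∑ i, tmul S (x i) (inv G i)) fun t => ?_
    induction t using induction_on with
    | zero =>
      refine Finset.sum_eq_zero fun i _ => ?_
      rw [map_zero, show inv 0 i = 0 from rfl, tmul_zero]
    | tmul p f =>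
      have : ∀ i, inv (tensorHom R S ω P I (tmul S p f)) i = (φ i p).unop • f := fun i => rfl
      simp only [this, ← smul_tmul, ← sum_tmul]
      exact congrArg (fun p => tmul S p f) (h p)
    | add t t' h h' =>
      simp only [map_add, inv_add, tmul_add, Finset.sum_add_distrib]
      exact congrArg₂ (· + ·) h h'
  · intro G
    refine ⟨∑ i, tmul S (x i) (inv G i), LinearMap.ext fun k => ?_⟩
    rw [map_sum, LinearMap.sum_apply]
    conv_rhs => rw [← hψ k, map_sum]
    rfl

end TensorHom

/-- The evaluation map `ω ⊗_S Hom_R(ω, M) → M`. -/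
def counitMap (M : Type u) [AddCommGroup M] [Module R M] :
    BTensor S ω (HomFrom R S ω M) →ₗ[R] M :=
  let φ : BTensor S ω (HomFrom R S ω M) →+ M := lift S
    (AddMonoidHom.mk' (fun x => AddMonoidHom.mk'
      (fun f : HomFrom R S ω M => (show ω →ₗ[R] M from f) x) (fun _ _ => rfl))
      (fun x x' => by
        ext f
        exact map_add (show ω →ₗ[R] M from f) x x'))
    (fun _ _ _ => rfl)
  { toFun := φ
    map_add' := map_add φ
    map_smul' := fun r t => by
      induction t using induction_on with
      | zero => simp
      | tmul x f => exact map_smul (show ω →ₗ[R] M from f) r x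
      | add t t' h h' => rw [smul_add, map_add, map_add, smul_add, h, h'] }

theorem counitMap_naturality {M M' : Type u} [AddCommGroup M] [Module R M] [AddCommGroup M']
    [Module R M'] (f : M →ₗ[R] M') (t : BTensor S ω (HomFrom R S ω M)) :
    counitMap R S ω M' (lMap S ω (HomFrom.map R S ω f) t) = f (counitMap R S ω M t) := by
  induction t using induction_on with
  | zero => simp
  | tmul x g => rfl
  | add t t' h h' => simp only [map_add, h, h']

/-! ### Injective modules: Tor vanishing and the counit -/

section Injective

variable {R S ω} (Q : ProjRes Sᵐᵒᵖ ω) [Q.DegreewiseFinite] {I : Type u} [AddCommGroup I]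
  [Module R I] (hI : Module.Injective R I)
include Q hI

/-- `Q ⊗ I_*` is obtained from `Hom(Q, ω)` by the exact functor `Hom_R(-, I)`. -/
theorem torVanishes_homFrom_of_injective {i : ℕ} (h : Q.ExtVanishes i ω) :
    Q.TorVanishes i (HomFrom R S ω I) := by
  have : SMulCommClass Sᵐᵒᵖ R ω := SMulCommClass.symm _ _ _
  intro t
  constructor
  · intro ht
    have h₁ := tensorHom_rTensor R S ω (Q.d i) t
    rw [ht, map_zero] at h₁
    obtain ⟨G, hG⟩ := exists_extension_of_exact hI (h.exact_precomp R Q) _ h₁.symm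
    obtain ⟨t', rfl⟩ := (tensorHom_bijective R S ω).2 G
    refine ⟨t', (tensorHom_bijective R S ω).1 ?_⟩
    rw [tensorHom_rTensor, hG]
  · rintro ⟨s, rfl⟩
    rw [rTensor_rTensor, Q.d_comp_d, rTensor_zero]

/-- Applying `Hom_R(-, I)` to `0 → R → Hom(Q₀, ω) → Hom(Q₁, ω)` gives an exact sequence `Q₁ ⊗ I_* →
Q₀ ⊗ I_* → I → 0`. The cokernel of its first map is `ω ⊗ I_*`. -/
theorem counitMap_bijective_of_injective
    (h : Function.Bijective (fun r : R => Module.toModuleEnd Sᵐᵒᵖ ω r)) :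
    Function.Bijective (counitMap R S ω I) := by
  have : SMulCommClass Sᵐᵒᵖ R ω := SMulCommClass.symm _ _ _
  let α := LinearMap.toSpanSingleton R (Q.P 0 →ₗ[Sᵐᵒᵖ] ω) Q.ε
  have hα : Function.Injective α := Q.toSpanSingleton_ε_injective R fun t ht =>
    h.1 (LinearMap.ext fun x => (ht x).trans (zero_smul R x).symm)
  have hex : Function.Exact α (precomp R ω (Q.d 0)) := Q.exact_toSpanSingleton_ε R fun g => by
    obtain ⟨r, hr⟩ := h.2 g
    exact ⟨r, fun x => LinearMap.congr_fun hr x⟩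
  have hε : ∀ t : BTensor S (Q.P 0) (HomFrom R S ω I),
      counitMap R S ω I (rTensor S _ Q.ε t) = tensorHom R S ω _ I t Q.ε := by
    intro t
    induction t using induction_on with
    | zero => simp
    | tmul p f => rw [rTensor_tmul]; rfl
    | add t t' h h' => simp only [map_add, h, h', LinearMap.add_apply]
  constructor
  · refine (injective_iff_map_eq_zero _).2 fun t ht => ?_
    obtain ⟨t, rfl⟩ := rTensor_surjective S Q.surjective t
    rw [hε] at ht
    obtain ⟨G, hG⟩ := exists_extension_of_exact hI hex (tensorHom R S ω _ I t)
      (LinearMap.ext_ring (by simpa [α] using ht))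
    obtain ⟨t', rfl⟩ := (tensorHom_bijective R S ω).2 G
    rw [← tensorHom_rTensor] at hG
    rw [← (tensorHom_bijective R S ω).1 hG, rTensor_rTensor, Q.ε_comp_d, rTensor_zero]
  · intro y
    -- Extending `1 ↦ y` along `α` yields `G` with `G ε = y`.
    obtain ⟨G, hG⟩ := hI.out α hα (LinearMap.toSpanSingleton R I y)
    obtain ⟨t, rfl⟩ := (tensorHom_bijective R S ω).2 G
    refine ⟨rTensor S _ Q.ε t, ?_⟩
    rw [hε]
    simpa [α] using hG 1

end Injective

/-! ### Exactness properties of `Hom_R(ω, -)` and `ω ⊗_S -` -/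

section Functors

variable {A B C : Type u} [AddCommGroup A] [Module R A] [AddCommGroup B] [Module R B]
  [AddCommGroup C] [Module R C] {f : A →ₗ[R] B} {g : B →ₗ[R] C}

theorem HomFrom.map_injective (hf : Function.Injective f) :
    Function.Injective (HomFrom.map R S ω f) := fun _ _ h =>
  LinearMap.ext fun x => hf (LinearMap.congr_fun h x)

theorem HomFrom.map_exact (hf : Function.Injective f) (hfg : Function.Exact f g) :
    Function.Exact (HomFrom.map R S ω f) (HomFrom.map R S ω g) := by
  intro h
  constructor
  · exact fun hh => ProjRes.exists_lift_left hf hfg h hh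
  · rintro ⟨k, rfl⟩
    exact LinearMap.ext fun x => hfg.apply_apply_eq_zero _

/-- The isomorphism `A_* ≃ B_*` induced by an isomorphism `A ≃ B`. -/
def HomFrom.congr (e : A ≃ₗ[R] B) : HomFrom R S ω A ≃ₗ[S] HomFrom R S ω B :=
  LinearEquiv.ofBijective (HomFrom.map R S ω e.toLinearMap)
    ⟨HomFrom.map_injective R S ω e.injective, fun h =>
      ⟨e.symm.toLinearMap.comp (show ω →ₗ[R] B from h), LinearMap.ext fun x =>
        e.apply_symm_apply ((show ω →ₗ[R] B from h) x)⟩⟩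

/-- The isomorphism `ω ⊗ N ≃ ω ⊗ N'` induced by an isomorphism `N ≃ N'`. -/
def tensorCongr {N N' : Type u} [AddCommGroup N] [Module S N] [AddCommGroup N'] [Module S N']
    (e : N ≃ₗ[S] N') : BTensor S ω N ≃ₗ[R] BTensor S ω N' :=
  LinearEquiv.ofBijective (lTensor S ω R e.toLinearMap)
    ⟨Function.LeftInverse.injective (g := lMap S ω e.symm.toLinearMap) fun t => by
      rw [lTensor_eq_lMap, lMap_lMap]; simp, lMap_surjective S e.surjective⟩

end Functors

variable {R S ω}

/-! ### Transport of resolutions -/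

section Transport

variable (P : ProjRes R ω) (Q : ProjRes Sᵐᵒᵖ ω) [Q.DegreewiseFinite]

/-- The modules isomorphic to `ω ⊗_S F` with `F` in `𝒳`. -/
def TensorClass (R : Type u) {S : Type u} [Ring R] [Ring S] (ω : Type u) [AddCommGroup ω]
    [Module R ω] [Module Sᵐᵒᵖ ω] [SMulCommClass R Sᵐᵒᵖ ω] (𝒳 : ModuleCat.{u} S → Prop)
    (M : ModuleCat.{u} R) : Prop :=
  ∃ F : ModuleCat.{u} S, 𝒳 F ∧ Nonempty (M ≃ₗ[R] BTensor S ω F)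

/-- The Ext vanishing is carried through the induction because surjectivity of `X_* → M_*` is
governed by `Ext¹(ω, K)` for the syzygy `K`. -/
theorem hasResolution_homFrom [P.DegreewiseFinite] (hω : IsSemidualizing R S ω) {𝒳 : ModuleCat.{u} S → Prop}
    (h𝒳 : ∀ F, 𝒳 F → IsFlat S F) (h𝒳' : ∀ F F' : ModuleCat.{u} S, (F ≃ₗ[S] F') → 𝒳 F → 𝒳 F')
    (n : ℕ) (M : ModuleCat.{u} R) (h : HasResolution (TensorClass R ω 𝒳) M n) :
    (∀ i, P.ExtVanishes i M) ∧ HasResolution 𝒳 (ModuleCat.of S (HomFrom R S ω M)) n := by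
  have hX : ∀ X : ModuleCat.{u} R, TensorClass R ω 𝒳 X →
      (∀ i, P.ExtVanishes i X) ∧ 𝒳 (ModuleCat.of S (HomFrom R S ω X)) := by
    rintro X ⟨F, hF, ⟨e⟩⟩
    refine ⟨fun i => (extVanishes_tensor_of_isFlat P (h𝒳 F hF)
      (P.extVanishes_of_subsingleton_ext (ModuleCat.of R ω) i
        (hω.ext_left (i + 1) (Nat.succ_pos i)))).of_equiv P e.symm, ?_⟩
    exact h𝒳' F _ ((LinearEquiv.ofBijective _
      (unitMap_bijective_of_isFlat P (h𝒳 F hF) hω.homothety_right)).trans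
        (HomFrom.congr R S ω e.symm)) hF
  induction n generalizing M with
  | zero =>
    obtain ⟨X, h, ⟨e⟩⟩ := hasResolution_zero_iff.1 h
    exact ⟨fun i => ((hX X h).1 i).of_equiv P e,
      hasResolution_zero_iff.2 ⟨_, (hX X h).2, ⟨HomFrom.congr R S ω e⟩⟩⟩
  | succ n ih =>
    obtain ⟨K, X, f, g, h, hK, hf, hg, hfg⟩ := hasResolution_succ_iff.1 h
    obtain ⟨hK, hK'⟩ := ih K hK
    refine ⟨fun i => .of_shortExact P hf hg hfg (hK (i + 1)) ((hX X h).1 i),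
      hasResolution_succ_iff.2 ⟨_, _, HomFrom.map R S ω f, HomFrom.map R S ω g, (hX X h).2, hK',
        HomFrom.map_injective R S ω hf, ?_, HomFrom.map_exact R S ω hf hfg⟩⟩
    exact fun c => (hK 0).exists_lift P hf hg hfg c

/-- Tor vanishing descends from `N` to its syzygy because the middle term is flat, and `Tor₁(ω, N) =
0` keeps the tensored sequence exact on the left. -/
theorem hasResolution_tensor {𝒳 : ModuleCat.{u} S → Prop} (h𝒳 : ∀ F, 𝒳 F → IsFlat S F) (n : ℕ)
    (N : ModuleCat.{u} S) (hN : ∀ i, Q.TorVanishes i N) (h : HasResolution 𝒳 N n) :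
    HasResolution (TensorClass R ω 𝒳) (ModuleCat.of R (BTensor S ω N)) n := by
  induction n generalizing N with
  | zero =>
    obtain ⟨X, h, ⟨e⟩⟩ := hasResolution_zero_iff.1 h
    exact hasResolution_zero_iff.2 ⟨ModuleCat.of R (BTensor S ω X),
      ⟨X, h, ⟨LinearEquiv.refl R _⟩⟩, ⟨tensorCongr R S ω e⟩⟩
  | succ n ih =>
    obtain ⟨K, X, f, g, h, hK, hf, hg, hfg⟩ := hasResolution_succ_iff.1 h
    exact hasResolution_succ_iff.2 ⟨ModuleCat.of R (BTensor S ω K), ModuleCat.of R (BTensor S ω X),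
      lTensor S ω R f, lTensor S ω R g, ⟨X, h, ⟨LinearEquiv.refl R _⟩⟩,
      ih K (fun i => .of_shortExact Q hf hg hfg (Q.torVanishes_of_isFlat i (h𝒳 X h)) (hN (i + 1)))
        hK, (hN 0).lMap_injective Q hf hg hfg, lMap_surjective S hg, lMap_exact S hfg hg⟩

/-- Here the induction carries Tor vanishing from the cosyzygy `K` up to `N`; `Tor₁(ω, K) = 0` makes
`ω ⊗ N → ω ⊗ X` injective. -/
theorem hasCoresolution_tensor (hω : IsSemidualizing R S ω) (n : ℕ) (N : ModuleCat.{u} S)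
    (h : HasCoresolution (IsOmegaInjective R S ω) N n) :
    (∀ i, Q.TorVanishes i N) ∧ HasCoresolution
      (fun I : ModuleCat.{u} R => Module.Injective R I) (ModuleCat.of R (BTensor S ω N)) n := by
  have hX : ∀ X : ModuleCat.{u} S, IsOmegaInjective R S ω X →
      (∀ i, Q.TorVanishes i X) ∧ Module.Injective R (BTensor S ω X) := by
    rintro X ⟨I, hI, ⟨e⟩⟩
    refine ⟨fun i => (torVanishes_homFrom_of_injective Q hI
      (Q.extVanishes_of_subsingleton_ext (ModuleCat.of Sᵐᵒᵖ ω) i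
        (hω.ext_right (i + 1) (Nat.succ_pos i)))).of_equiv Q e.symm, ?_⟩
    let e' := (tensorCongr R S ω e).trans (LinearEquiv.ofBijective _
      (counitMap_bijective_of_injective Q hI hω.homothety_left))
    refine ⟨fun A B _ _ _ _ f hf g => ?_⟩
    obtain ⟨k, hk⟩ := hI.out f hf (e'.toLinearMap.comp g)
    refine ⟨e'.symm.toLinearMap.comp k, fun x => ?_⟩
    rw [LinearMap.comp_apply, hk]
    exact e'.symm_apply_apply _
  induction n generalizing N with
  | zero =>
    obtain ⟨X, h, ⟨e⟩⟩ := hasCoresolution_zero_iff.1 h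
    exact ⟨fun i => ((hX X h).1 i).of_equiv Q e,
      hasCoresolution_zero_iff.2 ⟨ModuleCat.of R (BTensor S ω X), (hX X h).2,
        ⟨tensorCongr R S ω e⟩⟩⟩
  | succ n ih =>
    obtain ⟨X, K, f, g, h, hK, hf, hg, hfg⟩ := hasCoresolution_succ_iff.1 h
    obtain ⟨hK, hK'⟩ := ih K hK
    exact ⟨fun i => .of_shortExact Q hf hg hfg ((hX X h).1 i) (hK (i + 1)),
      hasCoresolution_succ_iff.2 ⟨ModuleCat.of R (BTensor S ω X),
        ModuleCat.of R (BTensor S ω K), lTensor S ω R f,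
        lTensor S ω R g, (hX X h).2, hK', (hK 0).lMap_injective Q hf hg hfg,
        lMap_surjective S hg, lMap_exact S hfg hg⟩⟩

/-- Ext vanishing passes from `M` to its cosyzygy since the middle term is injective; `Ext¹(ω, M) =
0` gives surjectivity onto `K_*`. -/
theorem hasCoresolution_homFrom (n : ℕ) (M : ModuleCat.{u} R) (hM : ∀ i, P.ExtVanishes i M)
    (h : HasCoresolution (fun I : ModuleCat.{u} R => Module.Injective R I) M n) :
    HasCoresolution (IsOmegaInjective R S ω) (ModuleCat.of S (HomFrom R S ω M)) n := by
  induction n generalizing M with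
  | zero =>
    obtain ⟨X, h, ⟨e⟩⟩ := hasCoresolution_zero_iff.1 h
    exact hasCoresolution_zero_iff.2 ⟨ModuleCat.of S (HomFrom R S ω X),
      ⟨X, h, ⟨LinearEquiv.refl S _⟩⟩, ⟨HomFrom.congr R S ω e⟩⟩
  | succ n ih =>
    obtain ⟨X, K, f, g, h, hK, hf, hg, hfg⟩ := hasCoresolution_succ_iff.1 h
    exact hasCoresolution_succ_iff.2 ⟨ModuleCat.of S (HomFrom R S ω X), _, HomFrom.map R S ω f,
      HomFrom.map R S ω g, ⟨X, h, ⟨LinearEquiv.refl S _⟩⟩,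
      ih K (fun i => .of_shortExact P hf hg hfg (hM (i + 1)) (P.extVanishes_of_injective i h)) hK,
      HomFrom.map_injective R S ω hf, fun c => (hM 0).exists_lift P hf hg hfg c,
      HomFrom.map_exact R S ω hf hfg⟩

/-- An `∞`-`ω`-cotorsionfree module `M` satisfies `Torᵢ(ω, M_*) = 0` for `i ≥ 1` and
`ω ⊗_S M_* ≃ M`. -/
theorem IsInftyCotorsionfree.torVanishes_and_counitMap_bijective (hω : IsSemidualizing R S ω)
    {M : ModuleCat.{u} R} (hM : IsInftyCotorsionfree R S ω M) :
    (∀ i, Q.TorVanishes i (HomFrom R S ω M)) ∧ Function.Bijective (counitMap R S ω M) := by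
  have hI : ∀ (I : ModuleCat.{u} R), Module.Injective R I → ∀ i,
      Q.TorVanishes i (HomFrom R S ω I) := fun I hI i =>
    torVanishes_homFrom_of_injective Q hI (Q.extVanishes_of_subsingleton_ext (ModuleCat.of Sᵐᵒᵖ ω) i
      (hω.ext_right (i + 1) (Nat.succ_pos i)))
  have key : ∀ n, Q.TorVanishes n (HomFrom R S ω M) ∧ Function.Bijective (counitMap R S ω M) := by
    intro n
    -- `TorVanishes n` concerns `Torₙ₊₁`, and `M_*` lies two syzygies below `Coker f_*`, so
    -- vanishing up to degree `n + 3` is needed. The copresentation may depend on `n`.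
    obtain ⟨I₀, I₁, η, f, hmin, htor⟩ := hM (n + 3)
    have hC : ∀ i ≤ n + 2, Q.TorVanishes i (cokerStar R S ω f) := fun i hi =>
      torVanishes_of_isZero_tor R S ω Q i _ (htor (i + 1) (by omega) (by omega))
    let φ := HomFrom.map R S ω f
    have hιπ : Function.Exact (LinearMap.range φ).subtype (LinearMap.range φ).mkQ := fun x => by
      simp
    have hηφ : Function.Exact (HomFrom.map R S ω η) φ.rangeRestrict := fun x => by
      rw [← HomFrom.map_exact R S ω hmin.mono hmin.exact x]
      exact Subtype.coe_inj (b := (0 : LinearMap.range φ)).symm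
    have hη := HomFrom.map_injective R S ω hmin.mono
    have hL : ∀ i ≤ n + 1, Q.TorVanishes i (LinearMap.range φ) := fun i hi =>
      .of_shortExact Q (Submodule.subtype_injective _) (Submodule.mkQ_surjective _) hιπ
        (hI I₁ hmin.injective_one i) (hC (i + 1) (by omega))
    have hι := (hC 0 (by omega)).lMap_injective Q (Submodule.subtype_injective _)
      (Submodule.mkQ_surjective _) hιπ
    have hη' := (hL 0 (by omega)).lMap_injective Q hη φ.surjective_rangeRestrict hηφ
    have e₀ := counitMap_bijective_of_injective Q hmin.injective_zero hω.homothety_left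
    have e₁ := counitMap_bijective_of_injective Q hmin.injective_one hω.homothety_left
    refine ⟨.of_shortExact Q hη φ.surjective_rangeRestrict hηφ (hI I₀ hmin.injective_zero n)
      (hL (n + 1) le_rfl), ?_, ?_⟩
    · refine (injective_iff_map_eq_zero _).2 fun t ht => ?_
      refine (injective_iff_map_eq_zero _).1 hη' _ ((injective_iff_map_eq_zero _).1 e₀.1 _ ?_)
      rw [counitMap_naturality, ht, map_zero]
    -- By the vanishing of `Tor₁(ω, Coker f_*)`, `ω ⊗ range φ` embeds in `ω ⊗ (I₁)_*`. Hence the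
    -- preimage of `η m` in `ω ⊗ (I₀)_*` already dies in `ω ⊗ range φ` and comes from `ω ⊗ M_*`.
    · intro m
      obtain ⟨t, ht⟩ := e₀.2 (η m)
      have h₁ : lMap S ω φ t = 0 := by
        apply e₁.1
        rw [counitMap_naturality, ht, hmin.exact.apply_apply_eq_zero, map_zero]
      have h₂ : lMap S ω φ.rangeRestrict t = 0 := by
        apply hι
        rw [lMap_lMap, map_zero]
        exact h₁
      obtain ⟨t', rfl⟩ := (lMap_exact S hηφ φ.surjective_rangeRestrict t).1 h₂
      rw [counitMap_naturality] at ht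
      exact ⟨t', hmin.mono ht⟩
  exact ⟨fun n => (key n).1, (key 0).2⟩

end Transport

end Bimodule

/-- The comparison of relative dimensions for a class of flat modules closed under isomorphisms. -/
theorem relProjDim_homFrom {R S : Type u} [Ring R] [Ring S] {ω : Type u} [AddCommGroup ω]
    [Module R ω] [Module Sᵐᵒᵖ ω] [SMulCommClass R Sᵐᵒᵖ ω] (hω : IsSemidualizing R S ω)
    {𝒳 : ModuleCat.{u} S → Prop} (h𝒳 : ∀ F, 𝒳 F → IsFlat S F)
    (h𝒳' : ∀ F F' : ModuleCat.{u} S, (F ≃ₗ[S] F') → 𝒳 F → 𝒳 F') (M : ModuleCat.{u} R) :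
    relProjDim 𝒳 (ModuleCat.of S (HomFrom R S ω M)) ≤ relProjDim (TensorClass R ω 𝒳) M ∧
      (IsInftyCotorsionfree R S ω M →
        relProjDim 𝒳 (ModuleCat.of S (HomFrom R S ω M)) = relProjDim (TensorClass R ω 𝒳) M) := by
  obtain ⟨P, hP⟩ := hω.finite_res_left.exists_projRes
  obtain ⟨Q, hQ⟩ := hω.finite_res_right.exists_projRes
  have h : relProjDim 𝒳 (ModuleCat.of S (HomFrom R S ω M)) ≤ relProjDim (TensorClass R ω 𝒳) M :=
    relProjDim_le_of_forall fun n hn => (hasResolution_homFrom P hω h𝒳 h𝒳' n M hn).2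
  refine ⟨h, fun hM => h.antisymm (relProjDim_le_of_forall fun n hn => ?_)⟩
  obtain ⟨h₁, h₂⟩ := hM.torVanishes_and_counitMap_bijective Q hω
  have h₃ := hasResolution_tensor (R := R) Q h𝒳 n (ModuleCat.of S (HomFrom R S ω M)) h₁ hn
  exact h₃.of_equiv (LinearEquiv.ofBijective (counitMap R S ω M) h₂)

end SemiDual

end

/-! ### The main theorem -/

theorem theorem3p5 (R S : Type u) [Ring R] [Ring S] (ω : Type u) [AddCommGroup ω] [Module R ω]
    [Module Sᵐᵒᵖ ω] [SMulCommClass R Sᵐᵒᵖ ω] (hω : SemiDual.IsSemidualizing R S ω) :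
    (∀ M : ModuleCat.{u} R,
      SemiDual.flatDim (ModuleCat.of S (SemiDual.HomFrom R S ω M)) ≤
        SemiDual.relProjDim (SemiDual.IsOmegaFlat R S ω) M ∧
      (SemiDual.IsInftyCotorsionfree R S ω M →
        SemiDual.flatDim (ModuleCat.of S (SemiDual.HomFrom R S ω M)) =
          SemiDual.relProjDim (SemiDual.IsOmegaFlat R S ω) M)) ∧
    (∀ M : ModuleCat.{u} R,
      SemiDual.projDim (ModuleCat.of S (SemiDual.HomFrom R S ω M)) ≤
        SemiDual.relProjDim (SemiDual.IsOmegaProjective R S ω) M ∧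
      (SemiDual.IsInftyCotorsionfree R S ω M →
        SemiDual.projDim (ModuleCat.of S (SemiDual.HomFrom R S ω M)) =
          SemiDual.relProjDim (SemiDual.IsOmegaProjective R S ω) M)) ∧
    (∀ N : ModuleCat.{u} S,
      SemiDual.injDim (ModuleCat.of R (SemiDual.BTensor S ω N)) ≤
        SemiDual.relInjDim (SemiDual.IsOmegaInjective R S ω) N ∧
      (SemiDual.InAuslanderClass R S ω N →
        SemiDual.injDim (ModuleCat.of R (SemiDual.BTensor S ω N)) =
          SemiDual.relInjDim (SemiDual.IsOmegaInjective R S ω) N)) := by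
  refine ⟨fun M => ?_, fun M => ?_, fun N => ?_⟩
  -- `IsOmegaFlat` is definitionally `TensorClass` of the flat modules; likewise `IsOmegaProjective`
  -- for the projective ones.
  · exact SemiDual.relProjDim_homFrom hω (fun _ h => h) (fun _ _ e h => h.of_equiv S e) M
  · rw [SemiDual.projDim_eq_relProjDim]
    exact SemiDual.relProjDim_homFrom hω (𝒳 := fun P => Module.Projective S P)
      (fun _ _ => SemiDual.IsFlat.of_projective S) (fun _ _ e _ => Module.Projective.of_equiv' e) M
  · obtain ⟨P, hP⟩ := hω.finite_res_left.exists_projRes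
    obtain ⟨Q, hQ⟩ := hω.finite_res_right.exists_projRes
    rw [SemiDual.injDim_eq_relInjDim]
    have h : SemiDual.relInjDim (fun I : ModuleCat.{u} R => Module.Injective R I)
        (ModuleCat.of R (SemiDual.BTensor S ω N)) ≤
          SemiDual.relInjDim (SemiDual.IsOmegaInjective R S ω) N :=
      SemiDual.relInjDim_le_of_forall fun n hn => (SemiDual.hasCoresolution_tensor Q hω n N hn).2
    refine ⟨h, fun hN => h.antisymm (SemiDual.relInjDim_le_of_forall fun n hn => ?_)⟩
    -- The coresolution obtained for `(ω ⊗ N)_*` is moved to `N` along the inverse of `μ_N`.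
    exact (SemiDual.hasCoresolution_homFrom P n (ModuleCat.of R (SemiDual.BTensor S ω N))
      (fun i => P.extVanishes_of_subsingleton_ext _ i (hN.ext_zero (i + 1) (Nat.succ_pos i)))
      hn).of_equiv (LinearEquiv.ofBijective _ hN.unit_bijective).symm
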